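/- Let $R$ be an ordered ring (commutative, unital, linearly ordered, with strictly positive products of strictly positive elements), $C = R(i)$ with $i^2=-1$, and let $H$ be a Hopf $^*$-algebra over $C$ (in Sweedler notation $\Delta(g) = g_{(1)}\otimes g_{(2)}$, with counit $\epsilon$ and antipode $S$). Let $A$ and $B$ be unital $^*$-algebras over $C$ with left $^*$-actions $\triangleright$ of $H$, i.e. left $H$-module structures with $g\triangleright(ab) = (g_{(1)}\triangleright a)(g_{(2)}\triangleright b)$, $g\triangleright 1=\epsilon(g)1$, $(g\triangleright a)^* = S(g)^*\triangleright a^*$. *Bimodules.* An inner product $(B,A)$-bimodule $E$ is a $(B,A)$-bimodule over $C$ with a non-degenerate map $\langle\cdot,\cdot\rangle\colon E\times E\to A$, $C$-linear in the second argument, such that $\langle x,y\rangle=\langle y,x\rangle^*$, $\langle x,y\cdot a\rangle=\langle x,y\rangle a$ and $\langle x,b\cdot y\rangle=\langle b^*\cdot x,y\rangle$. It is $H$-covariant if it carries a left $H$-module structure with $g\triangleright\langle x,y\rangle=\langle S(g_{(1)})^*\triangleright x,g_{(2)}\triangleright y\rangle$ and $g\triangleright(b\cdot x)=(g_{(1)}\triangleright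 b)\cdot(g_{(2)}\triangleright x)$. Its inner product is completely positive if, for all $n$ and $x_1,\dots,x_n\in E$, every positive linear functional $\omega$ on the $^*$-algebra $M_n(A)$ (i.e. $\omega(m^*m)\ge 0$ for all $m$) satisfies $\omega\big((\langle x_i,x_j\rangle)_{ij}\big)\ge 0$. The internal tensor product of $E$ and $F$ over $B$ is $E\otimes_B F$ with inner product $\langle x\otimes y,x'\otimes y'\rangle=\langle y,\langle x,x'\rangle\cdot y'\rangle$, divided by the degeneracy space of this inner product, with action $g\triangleright(x\otimes y)=(g_{(1)}\triangleright x)\otimes(g_{(2)}\triangleright y)$ in the $H$-covariant case; the unit is $A$ with $\langle a,b\rangle=a^*b$. *Picard groupoids.* $\mathrm{Pic}^*(B,A)$ is the class of isometric isomorphism classes of inner product $(B,A)$-bimodules which are invertible with respect to the internal tensor product; $\mathrm{StrPic}(B,A)$ is defined in the same way using only bimodules with completely positive inner products (also for the inverse), and $\mathrm{Pic}^*_H(B,A)$, $\mathrm{StrPic}_H(B,A)$ are defined in the same way using $H$-covariant bimodules and $H$-equivariant isometric isomorphisms. *Groups.* $\mathrm{GL}(H,B)$ is the group, under the convolution product $(\mathsf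 a*\mathsf b)(g)=\mathsf a(g_{(1)})\mathsf b(g_{(2)})$, of all linear maps $\mathsf a\colon H\to B$ with $\mathsf a(1)=1$, $\mathsf a(gh)=\mathsf a(g_{(1)})\,(g_{(2)}\triangleright\mathsf a(h))$ and $(g_{(1)}\triangleright b)\,\mathsf a(g_{(2)})=\mathsf a(g_{(1)})\,(g_{(2)}\triangleright b)$ for all $g,h\in H$, $b\in B$; $\mathrm U(H,B)$ is the subgroup of those with $\mathsf a(g_{(1)})\,\mathsf a(S(g_{(2)})^*)^*=\epsilon(g)1$. For a central unit $c$ of $B$ let $\hat c(g)=(g\triangleright c^{-1})c$. Put $\mathrm U_0(H,B)=\mathrm U(H,B)/\{\hat c: c \text{ a central unitary of } B\}$ and $\mathrm{GL}_0(H,B)=\mathrm{GL}(H,B)/\{\hat c: c\text{ a central unit of }B\}$. **Theorem.** (1) Suppose $\mathrm{StrPic}(B,A)$ is non-empty. Then either $\mathrm{StrPic}_H(B,A)$ is empty, or the map $\mathrm{StrPic}_H(B,A)\to\mathrm{StrPic}(B,A)$ that forgets the action of $H$ is a principal $\mathrm U_0(H,B)$-bundle over its image: changing the action of $H$ on $E$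 into $g\triangleright^{\mathsf a}x=\mathsf a(g_{(1)})\cdot(g_{(2)}\triangleright x)$, for $\mathsf a\in\mathrm U(H,B)$, induces a well-defined action of $\mathrm U_0(H,B)$ on $\mathrm{StrPic}_H(B,A)$, which preserves the fibres of the forgetful map and is free and transitive on each fibre over the image. (2) The same holds with $\mathrm{Pic}^*$ and $\mathrm{Pic}^*_H$ in place of $\mathrm{StrPic}$ and $\mathrm{StrPic}_H$. (3) Ring-theoretic version: let $k$ be a commutative ring, $H$ a Hopf algebra over $k$, and $A$, $B$ unital $k$-algebras with left $H$-module structures such that $g\triangleright(ab)=(g_{(1)}\triangleright a)(g_{(2)}\triangleright b)$ and $g\triangleright1=\epsilon(g)1$. Let $\mathrm{Pic}(B,A)$ be the class of isomorphism classes of invertible $(B,A)$-bimodules over $k$ (with respect to $\otimes$), and $\mathrm{Pic}_H(B,A)$ the class of isomorphism classes of invertible $H$-covariant bimodules, i.e. bimodules with a left $H$-module structure such that $g\triangleright(b\cdot x)=(g_{(1)}\triangleright b)\cdot(g_{(2)}\triangleright x)$ and $g\triangleright(x\cdot a)=(g_{(1)}\triangleright x)\cdot(g_{(2)}\triangleright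 a)$. If $\mathrm{Pic}(B,A)$ is non-empty, then either $\mathrm{Pic}_H(B,A)$ is empty, or the forgetful map from $\mathrm{Pic}_H(B,A)$ onto its image in $\mathrm{Pic}(B,A)$ is a principal $\mathrm{GL}_0(H,B)$-bundle in the same sense, for the action induced by $g\triangleright^{\mathsf a}x=\mathsf a(g_{(1)})\cdot(g_{(2)}\triangleright x)$, $\mathsf a\in\mathrm{GL}(H,B)$. -/

import Mathlib

open scoped TensorProduct

namespace HopfMorita

open Coalgebra HopfAlgebra WithConv

universe u v w

set_option linter.unusedSectionVars false

noncomputable section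

/-! ### Scalars, Hopf `*`-algebras and their actions -/

/-- The ring extension `R(i)` of `R` by a square root `i` of `-1`, with elements `re + im * i` and
the involution `re + im * i ↦ re - im * i`. -/
abbrev Cx (R : Type w) [CommRing R] : Type w := QuadraticAlgebra R (-1) 0

/-- A left action of a Hopf algebra `H` on a unital algebra `A`: a left `H`-module structure `act`
on `A` with `g ▷ (ab) = (g₁ ▷ a)(g₂ ▷ b)` and `g ▷ 1 = ε(g) 1`. Here and below a term
`r : Repr k g ι` is an expression `Δ(g) = ∑ i, r.left i ⊗ r.right i` as a finite sum, so that
Sweedler's notation `F(g₁, g₂)` becomes `∑ i ∈ r.index, F (r.left i) (r.right i)`. -/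
class HopfAction (k : Type w) (H : Type v) (A : Type u) [CommRing k] [Ring H] [HopfAlgebra k H]
    [Ring A] [Algebra k A] where
  act : H →ₐ[k] Module.End k A
  act_mul : ∀ (g : H) {ι : Type v} (r : Repr k g ι) (a b : A),
    act g (a * b) = ∑ i ∈ r.index, act (r.left i) a * act (r.right i) b
  act_one : ∀ g : H, act g 1 = algebraMap k A (counit g)

/-- The action `g ▷ a` of `g : H` on `a : A`. -/
abbrev hact (k : Type w) {H : Type v} {A : Type u} [CommRing k] [Ring H] [HopfAlgebra k H]
    [Ring A] [Algebra k A] [HopfAction k H A] (g : H) (a : A) : A :=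
  HopfAction.act (k := k) g a

/-- A Hopf `*`-algebra: a Hopf algebra which is a `*`-algebra such that `Δ` and `ε` are
`*`-homomorphisms and `S * S * = id`. -/
class HopfStarAlgebra (k : Type w) (H : Type v) [CommRing k] [StarRing k] [Ring H]
    [HopfAlgebra k H] [StarRing H] [StarModule k H] : Prop where
  comul_star : ∀ g : H, comul (R := k) (star g) = star (comul (R := k) g)
  counit_star : ∀ g : H, counit (R := k) (star g) = star (counit (R := k) g)
  antipode_star : ∀ g : H, antipode k (star (antipode k (star g))) = g

/-- A left `*`-action of a Hopf `*`-algebra `H` on a unital `*`-algebra `A`: a left action with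
`(g ▷ a)^* = S(g)^* ▷ a^*`. -/
class HopfStarAction (k : Type w) (H : Type v) (A : Type u) [CommRing k] [StarRing k] [Ring H]
    [HopfAlgebra k H] [StarRing H] [StarModule k H] [Ring A] [Algebra k A] [StarRing A]
    [StarModule k A] extends HopfAction k H A where
  act_star : ∀ (g : H) (a : A), star (act g a) = act (star (antipode k g)) (star a)

/-! ### Convolution: helper facts -/

section Convolution

variable {k : Type w} {H : Type v} [CommRing k] [Ring H] [HopfAlgebra k H]

/-- The map `g ↦ ∑ β (f g₁) (f' g₂)`. -/
def sw {X Y Z : Type*} [AddCommGroup X] [AddCommGroup Y] [AddCommGroup Z] [Module k X]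
    [Module k Y] [Module k Z] (β : X →ₗ[k] Y →ₗ[k] Z) (f : H →ₗ[k] X) (f' : H →ₗ[k] Y) :
    H →ₗ[k] Z :=
  TensorProduct.lift β ∘ₗ TensorProduct.map f f' ∘ₗ comul

theorem sw_apply {X Y Z ι : Type*} [AddCommGroup X] [AddCommGroup Y] [AddCommGroup Z] [Module k X]
    [Module k Y] [Module k Z] (β : X →ₗ[k] Y →ₗ[k] Z) (f : H →ₗ[k] X) (f' : H →ₗ[k] Y) {g : H}
    (r : Repr k g ι) : sw β f f' g = ∑ i ∈ r.index, β (f (r.left i)) (f' (r.right i)) := by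
  simp [sw, ← r.eq]

theorem sw_assoc {X Y Z XY YZ T : Type*} [AddCommGroup X] [AddCommGroup Y] [AddCommGroup Z]
    [AddCommGroup XY] [AddCommGroup YZ] [AddCommGroup T] [Module k X] [Module k Y] [Module k Z]
    [Module k XY] [Module k YZ] [Module k T]
    (β₁ : X →ₗ[k] Y →ₗ[k] XY) (β₂ : XY →ₗ[k] Z →ₗ[k] T)
    (β₃ : Y →ₗ[k] Z →ₗ[k] YZ) (β₄ : X →ₗ[k] YZ →ₗ[k] T)
    (h : ∀ x y z, β₂ (β₁ x y) z = β₄ x (β₃ y z))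
    (f : H →ₗ[k] X) (f' : H →ₗ[k] Y) (f'' : H →ₗ[k] Z) :
    sw β₂ (sw β₁ f f') f'' = sw β₄ f (sw β₃ f' f'') := by
  ext g
  have key := sum_tmul_tmul_eq (ℛ k g) (fun i => ℛ k ((ℛ k g).left i))
    (fun i => ℛ k ((ℛ k g).right i))
  let Φ : H ⊗[k] (H ⊗[k] H) →ₗ[k] T :=
    TensorProduct.lift β₄ ∘ₗ TensorProduct.map f (TensorProduct.lift β₃ ∘ₗ TensorProduct.map f' f'')
  have key' := congrArg Φ key
  simp only [Φ, map_sum, LinearMap.comp_apply, TensorProduct.map_tmul,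
    TensorProduct.lift.tmul] at key'
  rw [sw_apply _ _ _ (ℛ k g), sw_apply _ _ _ (ℛ k g)]
  simp only [sw_apply _ _ _ (ℛ k (_ : H)), map_sum, LinearMap.sum_apply, h]
  exact key'


theorem one_repr_conv {A : Type*} [Ring A] [Algebra k A] (a b : WithConv (H →ₗ[k] A)) :
    (a * b) 1 = a 1 * b 1 := by
  simp [LinearMap.convMul_apply, Algebra.TensorProduct.one_def]

theorem comp_conv {A D : Type*} [Ring A] [Algebra k A] [Ring D] [Algebra k D] (l : A →ₐ[k] D)
    (a b : WithConv (H →ₗ[k] A)) :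
    toConv (l.toLinearMap ∘ₗ (a * b).ofConv) =
      toConv (l.toLinearMap ∘ₗ a.ofConv) * toConv (l.toLinearMap ∘ₗ b.ofConv) := by
  apply ofConv_injective
  exact LinearMap.algHom_comp_convMul_distrib l a b

theorem comp_convOne {A D : Type*} [Ring A] [Algebra k A] [Ring D] [Algebra k D] (l : A →ₐ[k] D) :
    toConv (l.toLinearMap ∘ₗ (1 : WithConv (H →ₗ[k] A)).ofConv) = 1 := by
  ext g
  simp [LinearMap.convOne_def]

/-- The constant element `g ↦ ε(g) d`. -/
def constConv (k : Type w) (H : Type v) {D : Type*} [CommRing k] [Ring H] [HopfAlgebra k H]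
    [Ring D] [Algebra k D] (d : D) : WithConv (H →ₗ[k] D) :=
  toConv (LinearMap.toSpanSingleton k D d ∘ₗ counit)

theorem mul_constConv {D : Type*} [Ring D] [Algebra k D] (f : WithConv (H →ₗ[k] D)) (d : D)
    (g : H) : (f * constConv k H d) g = f g * d := by
  rw [(ℛ k g).convMul_apply]
  have := congrArg (fun t => f (TensorProduct.rid k H t)) (sum_tmul_counit_eq (ℛ k g))
  simp only [map_sum, TensorProduct.rid_tmul, one_smul] at this
  rw [← this]
  simp [constConv, Finset.sum_mul]

theorem constConv_mul {D : Type*} [Ring D] [Algebra k D] (f : WithConv (H →ₗ[k] D)) (d : D)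
    (g : H) : (constConv k H d * f) g = d * f g := by
  rw [(ℛ k g).convMul_apply]
  conv_rhs => rw [← sum_counit_smul (ℛ k g)]
  simp [constConv, Finset.mul_sum]

theorem antipode_comul (g : H) :
    comul (R := k) (antipode k g) =
      TensorProduct.map (antipode k) (antipode k) (TensorProduct.comm k H H (comul (R := k) g)) := by
  let i₁ : H →ₐ[k] H ⊗[k] H := Algebra.TensorProduct.includeLeft
  let i₂ : H →ₐ[k] H ⊗[k] H := Algebra.TensorProduct.includeRight
  let S : WithConv (H →ₗ[k] H) := toConv (antipode k)
  let I : WithConv (H →ₗ[k] H) := toConv LinearMap.id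
  have hS (f : H →ₐ[k] H ⊗[k] H) :
      toConv (f.toLinearMap ∘ₗ antipode k) * toConv f.toLinearMap =
        (1 : WithConv (H →ₗ[k] H ⊗[k] H)) := by
    have h := LinearMap.algHom_comp_convMul_distrib f S I
    rw [LinearMap.antipode_mul_id] at h
    apply ofConv_injective
    rw [show toConv f.toLinearMap = toConv (f.toLinearMap ∘ₗ I.ofConv) from rfl]
    refine h.symm.trans ?_
    ext x
    simp [LinearMap.convOne_def]
  have hΔ : toConv (comul (R := k) (A := H)) =
      toConv i₁.toLinearMap * toConv i₂.toLinearMap := by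
    ext x
    rw [(ℛ k x).convMul_apply]
    simp [i₁, i₂, (ℛ k x).eq]
  have hG : toConv (TensorProduct.map (antipode k) (antipode k) ∘ₗ
        (TensorProduct.comm k H H).toLinearMap ∘ₗ comul (R := k) (A := H)) =
      toConv (i₂.toLinearMap ∘ₗ antipode k) * toConv (i₁.toLinearMap ∘ₗ antipode k) := by
    ext x
    rw [(ℛ k x).convMul_apply]
    simp [i₁, i₂, ← (ℛ k x).eq]
  have h1 : toConv (TensorProduct.map (antipode k) (antipode k) ∘ₗ
        (TensorProduct.comm k H H).toLinearMap ∘ₗ comul (R := k) (A := H)) *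
      toConv (comul (R := k) (A := H)) = 1 := by
    rw [hΔ, hG, mul_assoc, ← mul_assoc (toConv (i₁.toLinearMap ∘ₗ antipode k)), hS i₁, one_mul,
      hS i₂]
  have h2 := left_inv_eq_right_inv h1 (LinearMap.comul_right_inv (R := k) (C := H))
  exact (congrArg (fun f => f.ofConv g) h2).symm

end Convolution

/-! ### The groups `GL(H, A)` and `U(H, A)` -/

section Groups

variable {k : Type w} {H : Type v} {A : Type u} [CommRing k] [Ring H] [HopfAlgebra k H]
  [Ring A] [Algebra k A] [HopfAction k H A]

/-- The defining conditions of `GL(H, A)` for a linear map `a : H → A`; the type `WithConv` equips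
linear maps with the convolution product `(a * b)(g) = a(g₁) b(g₂)`. -/
structure IsGL (a : WithConv (H →ₗ[k] A)) : Prop where
  map_one : a 1 = 1
  map_mul : ∀ (g h : H) {ι : Type v} (r : Repr k g ι),
    a (g * h) = ∑ i ∈ r.index, a (r.left i) * hact k (r.right i) (a h)
  comm : ∀ (g : H) {ι : Type v} (r : Repr k g ι) (b : A),
    ∑ i ∈ r.index, hact k (r.left i) b * a (r.right i) =
      ∑ i ∈ r.index, a (r.left i) * hact k (r.right i) b

/-- The map `g ↦ g ▷ b`. -/
def orb (k : Type w) (H : Type v) {A : Type u} [CommRing k] [Ring H] [HopfAlgebra k H]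
    [Ring A] [Algebra k A] [HopfAction k H A] (b : A) : WithConv (H →ₗ[k] A) :=
  toConv ((HopfAction.act (k := k) (H := H) (A := A)).toLinearMap.flip b)

@[simp] theorem orb_apply (b : A) (g : H) : orb k H b g = hact k g b := rfl

theorem orb_mul (a b : A) : orb k H (a * b) = orb k H a * orb k H b := by
  ext g
  rw [(ℛ k g).convMul_apply]
  exact HopfAction.act_mul g (ℛ k g) a b

theorem orb_one : orb k H (1 : A) = 1 := by
  ext g
  exact HopfAction.act_one g

theorem IsGL.comm' {a : WithConv (H →ₗ[k] A)} (ha : IsGL a) (b : A) :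
    orb k H b * a = a * orb k H b := by
  ext g
  rw [(ℛ k g).convMul_apply, (ℛ k g).convMul_apply]
  exact ha.comm g (ℛ k g) b

theorem IsGL.map_mul' {a : WithConv (H →ₗ[k] A)} (ha : IsGL a) (g h : H) :
    a (g * h) = (a * orb k H (a h)) g := by
  rw [(ℛ k g).convMul_apply]
  exact ha.map_mul g h (ℛ k g)

theorem isGL_of {a : WithConv (H →ₗ[k] A)} (h1 : a 1 = 1)
    (h2 : ∀ g h, a (g * h) = (a * orb k H (a h)) g)
    (h3 : ∀ b, orb k H b * a = a * orb k H b) : IsGL a where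
  map_one := h1
  map_mul g h ι r := by rw [h2, r.convMul_apply]; rfl
  comm g ι r b := by
    have := congrArg (fun f => f g) (h3 b)
    simpa only [r.convMul_apply, orb_apply] using this

/-- The linear map `g ↦ ∑ a(g₁) · (g₂ ▷ -)` underlying the twisted action. -/
def twistLin {M : Type*} [AddCommGroup M] [Module k M] (l : A →ₐ[k] Module.End k M)
    (ρ : H →ₐ[k] Module.End k M) (a : WithConv (H →ₗ[k] A)) : WithConv (H →ₗ[k] Module.End k M) :=
  toConv (l.toLinearMap ∘ₗ a.ofConv) * toConv ρ.toLinearMap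

/-- Compatibility `g ▷ (b · x) = (g₁ ▷ b) · (g₂ ▷ x)` of actions on an `A`-module. -/
def LeftCompat {M : Type*} [AddCommGroup M] [Module k M] (l : A →ₐ[k] Module.End k M)
    (ρ : H →ₐ[k] Module.End k M) : Prop :=
  ∀ (g : H) {ι : Type v} (r : Repr k g ι) (b : A) (x : M),
    ρ g (l b x) = ∑ i ∈ r.index, l (hact k (r.left i) b) (ρ (r.right i) x)

section Twist

variable {M : Type*} [AddCommGroup M] [Module k M] {l : A →ₐ[k] Module.End k M}
    {ρ : H →ₐ[k] Module.End k M}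

theorem LeftCompat.conv (h : LeftCompat l ρ) (b : A) (g : H) :
    (toConv (l.toLinearMap ∘ₗ (orb k H b).ofConv) * toConv ρ.toLinearMap) g = ρ g * l b := by
  ext x
  rw [(ℛ k g).convMul_apply, LinearMap.sum_apply]
  exact (h g (ℛ k g) b x).symm

theorem twistLin_apply (a : WithConv (H →ₗ[k] A)) {g : H} {ι : Type*} (r : Repr k g ι) :
    twistLin l ρ a g = ∑ i ∈ r.index, l (a (r.left i)) * ρ (r.right i) := by
  rw [twistLin, r.convMul_apply]
  rfl

theorem twistLin_mul_orb (h : LeftCompat l ρ) (a : WithConv (H →ₗ[k] A)) (b : A) (g : H) :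
    twistLin l ρ (a * orb k H b) g = twistLin l ρ a g * l b := by
  rw [twistLin, comp_conv, mul_assoc, (ℛ k g).convMul_apply, twistLin_apply a (ℛ k g),
    Finset.sum_mul]
  refine Finset.sum_congr rfl fun i _ => ?_
  rw [h.conv, mul_assoc]
  rfl

/-- The twisted action `g ▷ᵃ x = a(g₁) · (g₂ ▷ x)` for `a` in `GL(H, A)`. -/
def twistAct (l : A →ₐ[k] Module.End k M) (ρ : H →ₐ[k] Module.End k M) (h : LeftCompat l ρ)
    (a : WithConv (H →ₗ[k] A)) (ha : IsGL a) : H →ₐ[k] Module.End k M :=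
  AlgHom.ofLinearMap (twistLin l ρ a).ofConv
    (by
      have : (twistLin l ρ a) 1 = 1 := by
        rw [twistLin, one_repr_conv]
        simp [ha.map_one]
      exact this)
    (by
      intro g g'
      change twistLin l ρ a (g * g') = twistLin l ρ a g * twistLin l ρ a g'
      rw [twistLin_apply a ((ℛ k g).mul (ℛ k g')), twistLin_apply a (ℛ k g'), Finset.mul_sum]
      simp only [← mul_assoc, ← twistLin_mul_orb h]
      simp only [twistLin_apply _ (ℛ k g), ← ha.map_mul', Finset.sum_mul]
      simp only [Coalgebra.Repr.mul_index, Coalgebra.Repr.mul_left, Coalgebra.Repr.mul_right,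
        Finset.sum_product_right, map_mul, mul_assoc])

theorem twistAct_apply (h : LeftCompat l ρ) {a : WithConv (H →ₗ[k] A)} (ha : IsGL a) {g : H}
    {ι : Type*} (r : Repr k g ι) (x : M) :
    twistAct l ρ h a ha g x = ∑ i ∈ r.index, l (a (r.left i)) (ρ (r.right i) x) := by
  change (twistLin l ρ a g) x = _
  rw [twistLin_apply a r, LinearMap.sum_apply]
  rfl

theorem twist_leftCompat (h : LeftCompat l ρ) {a : WithConv (H →ₗ[k] A)} (ha : IsGL a) :
    LeftCompat l (twistAct l ρ h a ha) := by
  intro g ι r b x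
  change (twistLin l ρ a g * l b) x = _
  rw [← twistLin_mul_orb h, ← ha.comm', twistLin, comp_conv, mul_assoc, r.convMul_apply,
    LinearMap.sum_apply]
  rfl

theorem twist_right {D : Type*} [Ring D] [Algebra k D] [HopfAction k H D] (h : LeftCompat l ρ)
    {a : WithConv (H →ₗ[k] A)} (ha : IsGL a) (s : Dᵐᵒᵖ →ₐ[k] Module.End k M)
    (hs : ∀ (b : A) (x : M) (d : D),
      l b (s (MulOpposite.op d) x) = s (MulOpposite.op d) (l b x))
    (hρ : ∀ (g : H) {ι : Type v} (r : Repr k g ι) (x : M) (d : D),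
      ρ g (s (MulOpposite.op d) x) =
        ∑ i ∈ r.index, s (MulOpposite.op (hact k (r.right i) d)) (ρ (r.left i) x))
    (g : H) {ι : Type v} (r : Repr k g ι) (x : M) (d : D) :
    twistAct l ρ h a ha g (s (MulOpposite.op d) x) =
      ∑ i ∈ r.index, s (MulOpposite.op (hact k (r.right i) d)) (twistAct l ρ h a ha (r.left i) x) := by
  let β₁ : A →ₗ[k] M →ₗ[k] M := l.toLinearMap
  let β₂ : M →ₗ[k] D →ₗ[k] M :=
    (s.toLinearMap ∘ₗ (MulOpposite.opLinearEquiv k).toLinearMap).flip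
  have key := sw_assoc β₁ β₂ β₂ β₁ (fun b x d => (hs b x d).symm) a.ofConv
    (ρ.toLinearMap.flip x) (orb k H d).ofConv
  have e1 (g : H) : sw β₁ a.ofConv (ρ.toLinearMap.flip x) g = twistAct l ρ h a ha g x := by
    rw [sw_apply _ _ _ (ℛ k g), twistAct_apply h ha (ℛ k g)]
    rfl
  have e2 (g : H) : sw β₂ (ρ.toLinearMap.flip x) (orb k H d).ofConv g =
      ρ g (s (MulOpposite.op d) x) := by
    rw [sw_apply _ _ _ (ℛ k g), hρ g (ℛ k g)]
    rfl
  have e3 := congrArg (fun f => f g) key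
  simp only [sw_apply _ _ _ r, e1, e2] at e3
  rw [twistAct_apply h ha r]
  exact e3.symm

end Twist

theorem leftCompat_self : LeftCompat (Algebra.lmul k A)
    (HopfAction.act : H →ₐ[k] Module.End k A) :=
  fun g _ r b x => HopfAction.act_mul g r b x

theorem antipode_conv {D : Type*} [Ring D] [Algebra k D] (f : H →ₐ[k] D) :
    toConv (f.toLinearMap ∘ₗ antipode k) * toConv f.toLinearMap = 1 ∧
      toConv f.toLinearMap * toConv (f.toLinearMap ∘ₗ antipode k) = 1 := by
  constructor
  · have h := LinearMap.algHom_comp_convMul_distrib f (toConv (antipode k))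
      (toConv (LinearMap.id : H →ₗ[k] H))
    rw [LinearMap.antipode_mul_id] at h
    apply ofConv_injective
    refine h.symm.trans ?_
    ext x
    simp [LinearMap.convOne_def]
  · have h := LinearMap.algHom_comp_convMul_distrib f
      (toConv (LinearMap.id : H →ₗ[k] H)) (toConv (antipode k))
    rw [LinearMap.id_mul_antipode] at h
    apply ofConv_injective
    refine h.symm.trans ?_
    ext x
    simp [LinearMap.convOne_def]

theorem IsGL.isUnit {a : WithConv (H →ₗ[k] A)} (ha : IsGL a) : IsUnit a := by
  let ρ : H →ₐ[k] Module.End k A := HopfAction.act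
  let L : A →ₐ[k] Module.End k A := Algebra.lmul k A
  let φ := twistAct L ρ leftCompat_self a ha
  have hφ : toConv φ.toLinearMap = toConv (L.toLinearMap ∘ₗ a.ofConv) * toConv ρ.toLinearMap := rfl
  let Λ : WithConv (H →ₗ[k] Module.End k A) := toConv (L.toLinearMap ∘ₗ a.ofConv)
  let Ψ : WithConv (H →ₗ[k] Module.End k A) :=
    toConv ρ.toLinearMap * toConv (φ.toLinearMap ∘ₗ antipode k)
  have hΛ : Λ = toConv φ.toLinearMap * toConv (ρ.toLinearMap ∘ₗ antipode k) := by
    rw [hφ, mul_assoc, (antipode_conv ρ).2, mul_one]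
  have h1 : Λ * Ψ = 1 := by
    rw [hΛ, mul_assoc, ← mul_assoc (toConv (ρ.toLinearMap ∘ₗ antipode k)), (antipode_conv ρ).1,
      one_mul, (antipode_conv φ).2]
  have h2 : Ψ * Λ = 1 := by
    rw [hΛ, mul_assoc, ← mul_assoc (toConv (φ.toLinearMap ∘ₗ antipode k)), (antipode_conv φ).1,
      one_mul, (antipode_conv ρ).2]
  let C (y : A) : WithConv (H →ₗ[k] Module.End k A) := constConv k H (LinearMap.mulRight k y)
  have hcomm (y : A) : C y * Λ = Λ * C y := by
    ext g x
    rw [constConv_mul, mul_constConv]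
    simp [Λ, L, mul_assoc]
  have hcomm' (y : A) : C y * Ψ = Ψ * C y := by
    calc C y * Ψ = (Ψ * Λ) * C y * Ψ := by rw [h2, one_mul]
      _ = Ψ * (C y * Λ) * Ψ := by rw [hcomm]; simp only [mul_assoc]
      _ = Ψ * C y * (Λ * Ψ) := by simp only [mul_assoc]
      _ = Ψ * C y := by rw [h1, mul_one]
  let b : WithConv (H →ₗ[k] A) := toConv (LinearMap.applyₗ (1 : A) ∘ₗ Ψ.ofConv)
  have hb : toConv (L.toLinearMap ∘ₗ b.ofConv) = Ψ := by
    ext g y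
    have := congrArg (fun f => f g (1 : A)) (hcomm' y)
    simp only [C, constConv_mul, mul_constConv] at this
    simpa [b, L] using this
  have hinj : Function.Injective
      (fun f : WithConv (H →ₗ[k] A) => toConv (L.toLinearMap ∘ₗ f.ofConv)) := by
    intro f f' h
    ext g
    have := congrArg (fun q => q g (1 : A)) h
    simpa [L] using this
  refine ⟨⟨a, b, hinj ?_, hinj ?_⟩, rfl⟩
  · change toConv (L.toLinearMap ∘ₗ (a * b).ofConv) = _
    rw [comp_conv, hb]
    refine Eq.trans ?_ (comp_convOne L).symm
    exact h1
  · change toConv (L.toLinearMap ∘ₗ (b * a).ofConv) = _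
    rw [comp_conv, hb]
    refine Eq.trans ?_ (comp_convOne L).symm
    exact h2


theorem act_counit_right (f : H →ₗ[k] A) (g : H) :
    ∑ i ∈ (ℛ k g).index, counit (R := k) ((ℛ k g).right i) • f ((ℛ k g).left i) = f g := by
  have := congrArg (fun t => f (TensorProduct.rid k H t)) (sum_tmul_counit_eq (ℛ k g))
  simpa only [map_sum, TensorProduct.rid_tmul, one_smul, map_smul] using this

/-- The algebra homomorphism `b ↦ (g ↦ g ▷ b)` into the convolution algebra. -/
def orbHom (k : Type w) (H : Type v) (A : Type u) [CommRing k] [Ring H] [HopfAlgebra k H]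
    [Ring A] [Algebra k A] [HopfAction k H A] : A →ₐ[k] WithConv (H →ₗ[k] A) :=
  AlgHom.ofLinearMap
    { toFun := orb k H
      map_add' := fun a b => by ext g; simp
      map_smul' := fun c a => by ext g; simp }
    orb_one orb_mul

theorem IsGL.mul {a b : WithConv (H →ₗ[k] A)} (ha : IsGL a) (hb : IsGL b) : IsGL (a * b) := by
  refine isGL_of ?_ ?_ ?_
  · rw [one_repr_conv, ha.map_one, hb.map_one, one_mul]
  · intro g h
    have e : orb k H ((a * b) h) = ∑ j ∈ (ℛ k h).index,
        orb k H (a ((ℛ k h).left j)) * orb k H (b ((ℛ k h).right j)) := by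
      rw [(ℛ k h).convMul_apply]
      change orbHom k H A _ = _
      rw [map_sum]
      exact Finset.sum_congr rfl fun j _ => orb_mul _ _
    rw [e, Finset.mul_sum, ((ℛ k g).mul (ℛ k h)).convMul_apply]
    simp only [Coalgebra.Repr.mul_index, Coalgebra.Repr.mul_left, Coalgebra.Repr.mul_right,
        Finset.sum_product_right, ha.map_mul', hb.map_mul']
    simp only [← (ℛ k g).convMul_apply]
    have e2 (x y : A) : a * orb k H x * (b * orb k H y) = a * b * (orb k H x * orb k H y) := by
      simp only [mul_assoc]
      rw [← mul_assoc (orb k H x) b, hb.comm']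
      simp only [mul_assoc]
    simp only [e2]
    simp [WithConv.ofConv_sum]
  · intro x
    rw [← mul_assoc, ha.comm', mul_assoc, hb.comm', mul_assoc]

theorem IsGL.one : IsGL (1 : WithConv (H →ₗ[k] A)) := by
  refine isGL_of ?_ ?_ ?_
  · simp
  · intro g h
    rw [one_mul]
    simp only [orb_apply, LinearMap.convOne_apply, Bialgebra.counit_mul, hact,
      Algebra.algebraMap_eq_smul_one (A := A), map_smul, HopfAction.act_one]
    rw [mul_smul, smul_comm]
  · intro b; simp

theorem IsGL.of_inv {a b : WithConv (H →ₗ[k] A)} (ha : IsGL a) (hab : a * b = 1)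
    (hba : b * a = 1) : IsGL b := by
  have comm (x : A) : orb k H x * b = b * orb k H x := by
    calc orb k H x * b = b * a * orb k H x * b := by rw [hba, one_mul]
      _ = b * (a * orb k H x) * b := by simp only [mul_assoc]
      _ = b * orb k H x * (a * b) := by rw [← ha.comm']; simp only [mul_assoc]
      _ = b * orb k H x := by rw [hab, mul_one]
  refine isGL_of ?_ ?_ comm
  · have := congrArg (fun f => f 1) hab
    simp only [one_repr_conv, ha.map_one] at this
    simpa using this
  · intro g h
    rw [← comm]
    let O (f : WithConv (H →ₗ[k] A)) : WithConv (H →ₗ[k] WithConv (H →ₗ[k] A)) :=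
      toConv ((orbHom k H A).toLinearMap ∘ₗ f.ofConv)
    let c : WithConv (H →ₗ[k] WithConv (H →ₗ[k] A)) :=
      toConv
        { toFun := fun h => toConv (b.ofConv ∘ₗ LinearMap.mulRight k h)
          map_add' := fun x y => by ext g; simp [mul_add]
          map_smul' := fun x y => by ext g; simp }
    have hO : O b * O a = 1 := by
      rw [← comp_conv, hba, comp_convOne]
    have h1 (h : H) : (O a * c) h = counit (R := k) h • b := by
      have e : a * (O a * c) h = counit (R := k) h • 1 := by
        ext g
        have e1 := congrArg (fun f => f (g * h)) hab
        simp only [((ℛ k g).mul (ℛ k h)).convMul_apply, Coalgebra.Repr.mul_index,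
          Coalgebra.Repr.mul_left, Coalgebra.Repr.mul_right, Finset.sum_product_right,
          ha.map_mul'] at e1
        rw [(ℛ k h).convMul_apply, Finset.mul_sum, WithConv.ofConv_sum, LinearMap.sum_apply]
        have e2 : ((1 : WithConv (H →ₗ[k] A)) (g * h)) =
            (counit (R := k) h • (1 : WithConv (H →ₗ[k] A))).ofConv g := by
          simp only [LinearMap.convOne_apply, Bialgebra.counit_mul, WithConv.ofConv_smul,
            LinearMap.smul_apply, Algebra.algebraMap_eq_smul_one (A := A)]
          rw [mul_smul, smul_comm]
        rw [← e2, ← e1]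
        refine Finset.sum_congr rfl fun j _ => ?_
        rw [← mul_assoc, (ℛ k g).convMul_apply]
        rfl
      calc (O a * c) h = b * (a * (O a * c) h) := by rw [← mul_assoc, hba, one_mul]
        _ = _ := by rw [e, mul_smul_comm, mul_one]
    have h2 : c = O b * (O a * c) := by rw [← mul_assoc, hO, one_mul]
    have h3 : c h = orb k H (b h) * b := by
      rw [h2, (ℛ k h).convMul_apply]
      simp only [h1]
      have e : orb k H (b h) = (orbHom k H A) (b h) := rfl
      rw [e, ← act_counit_right b.ofConv h, map_sum, Finset.sum_mul]
      refine Finset.sum_congr rfl fun j _ => ?_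
      rw [map_smul, mul_smul_comm, smul_mul_assoc]
      rfl
    have := congrArg (fun f => f g) h3
    simpa [c] using this

/-- The type `GL(H, A)` of linear maps `a : H → A` with `a(1) = 1`,
`a(gh) = a(g₁)(g₂ ▷ a(h))` and `(g₁ ▷ b) a(g₂) = a(g₁)(g₂ ▷ b)`. -/
@[ext]
structure GLH (k : Type w) (H : Type v) (A : Type u) [CommRing k] [Ring H] [HopfAlgebra k H]
    [Ring A] [Algebra k A] [HopfAction k H A] : Type (max u v) where
  val : WithConv (H →ₗ[k] A)
  isGL : IsGL val

/-- `GL(H, A)` is a group under convolution. -/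
instance : Group (GLH k H A) where
  mul a b := ⟨a.val * b.val, a.isGL.mul b.isGL⟩
  one := ⟨1, IsGL.one⟩
  inv a := ⟨Ring.inverse a.val, a.isGL.of_inv (Ring.mul_inverse_cancel _ a.isGL.isUnit)
    (Ring.inverse_mul_cancel _ a.isGL.isUnit)⟩
  mul_assoc a b c := GLH.ext (mul_assoc a.val b.val c.val)
  one_mul a := GLH.ext (one_mul a.val)
  mul_one a := GLH.ext (mul_one a.val)
  inv_mul_cancel a := GLH.ext (Ring.inverse_mul_cancel _ a.isGL.isUnit)

theorem GLH.coe_mul (a b : GLH k H A) : (a * b).val = a.val * b.val := rfl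

theorem GLH.coe_one : (1 : GLH k H A).val = 1 := rfl

theorem constConv_comm {c : A} (hc : c ∈ Subring.center A) (f : WithConv (H →ₗ[k] A)) :
    constConv k H c * f = f * constConv k H c := by
  ext g
  rw [constConv_mul, mul_constConv]
  exact (Subring.mem_center_iff.mp hc _).symm

theorem hat_aux {c d : A} (hc : c ∈ Subring.center A) (hd : d ∈ Subring.center A)
    (hdc : d * c = 1) : IsGL (orb k H d * constConv k H c) := by
  have hcd : c * d = 1 := by rw [Subring.mem_center_iff.mp hd c, hdc]
  refine isGL_of ?_ ?_ ?_
  · rw [mul_constConv]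
    simp [hact, hdc]
  · intro g h
    rw [mul_assoc, constConv_comm hc, ← mul_assoc, ← orb_mul, mul_constConv, mul_constConv,
      mul_constConv]
    have e : d * ((orb k H d) h * c) = (orb k H d) h := by
      rw [← Subring.mem_center_iff.mp hd, mul_assoc, hcd, mul_one]
    rw [e]
    simp [hact]
  · intro b
    rw [mul_assoc (orb k H d), constConv_comm hc, ← mul_assoc, ← mul_assoc, ← orb_mul, ← orb_mul,
      Subring.mem_center_iff.mp hd b]

/-- The element `ĉ : g ↦ (g ▷ c⁻¹) c` of `GL(H, A)` for a central unit `c`. -/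
def hat (k : Type w) (H : Type v) {A : Type u} [CommRing k] [Ring H] [HopfAlgebra k H]
    [Ring A] [Algebra k A] [HopfAction k H A] (c : (Subring.center A)ˣ) : GLH k H A :=
  ⟨toConv (LinearMap.mulRight k (c : A) ∘ₗ
      (HopfAction.act (k := k) (H := H) (A := A)).toLinearMap.flip
        ((c⁻¹ : (Subring.center A)ˣ) : A)), by
    have h := hat_aux (k := k) (H := H) (c : Subring.center A).2
      ((c⁻¹ : (Subring.center A)ˣ) : Subring.center A).2
      (congrArg Subtype.val c.inv_mul)
    convert h using 1
    ext g
    rw [mul_constConv]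
    rfl⟩

theorem hat_apply (c : (Subring.center A)ˣ) (g : H) :
    (hat k H c).val g = hact k g ((c⁻¹ : (Subring.center A)ˣ) : A) * (c : A) := rfl

theorem hat_eq (c : (Subring.center A)ˣ) :
    (hat k H c).val = orb k H ((c⁻¹ : (Subring.center A)ˣ) : A) * constConv k H (c : A) := by
  ext g
  rw [mul_constConv]
  rfl

/-- The group homomorphism `c ↦ ĉ` from `GL(Z(A))` to `GL(H, A)`. -/
def hatHom (k : Type w) (H : Type v) (A : Type u) [CommRing k] [Ring H] [HopfAlgebra k H]
    [Ring A] [Algebra k A] [HopfAction k H A] : (Subring.center A)ˣ →* GLH k H A :=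
  MonoidHom.mk' (hat k H) (by
    intro c d
    apply GLH.ext
    rw [GLH.coe_mul, hat_eq, hat_eq, hat_eq, mul_assoc (orb k H _), ← mul_assoc (constConv k H _),
      constConv_comm (c : Subring.center A).2, mul_assoc (orb k H _), ← mul_assoc, ← orb_mul]
    ext g
    rw [← mul_assoc, mul_constConv, mul_constConv, mul_constConv]
    rw [mul_inv]
    simp only [Units.val_mul, Subring.coe_mul, orb_apply, mul_assoc])

theorem hat_central (c : (Subring.center A)ˣ) (a : GLH k H A) :
    a * hatHom k H A c = hatHom k H A c * a := by
  apply GLH.ext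
  change a.val * (hat k H c).val = (hat k H c).val * a.val
  rw [hat_eq, ← mul_assoc, ← a.isGL.comm', mul_assoc, mul_assoc,
    constConv_comm (c : Subring.center A).2]

instance : (hatHom k H A).range.Normal where
  conj_mem := by
    rintro _ ⟨c, rfl⟩ a
    exact ⟨c, by rw [hat_central, mul_inv_cancel_right]⟩

/-- The group `GL₀(H, A)`, the quotient of `GL(H, A)` by the image of `GL(Z(A))`. -/
abbrev GL₀ (k : Type w) (H : Type v) (A : Type u) [CommRing k] [Ring H] [HopfAlgebra k H]
    [Ring A] [Algebra k A] [HopfAction k H A] : Type (max u v) :=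
  GLH k H A ⧸ (hatHom k H A).range


end Groups

section StarGroups

variable {k : Type w} {H : Type v} {A : Type u} [CommRing k] [StarRing k] [Ring H]
    [HopfAlgebra k H] [StarRing H] [StarModule k H] [HopfStarAlgebra k H]
    [Ring A] [Algebra k A] [StarRing A] [StarModule k A] [HopfStarAction k H A]

/-- The unitarity condition `a(g₁) a(S(g₂)^*)^* = ε(g) 1`. -/
def IsUnitaryH (a : WithConv (H →ₗ[k] A)) : Prop :=
  ∀ (g : H) {ι : Type v} (r : Repr k g ι),
    ∑ i ∈ r.index, a (r.left i) * star (a (star (antipode k (r.right i)))) =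
      algebraMap k A (counit g)

theorem antipode_star' (g : H) : antipode k (star (antipode k g)) = star g := by
  simpa using HopfStarAlgebra.antipode_star (k := k) (star g)

/-- The map `g ↦ a(S(g)^*)^*`. -/
def dagger (a : WithConv (H →ₗ[k] A)) : WithConv (H →ₗ[k] A) :=
  toConv
    { toFun := fun g => star (a (star (antipode k g)))
      map_add' := fun x y => by simp
      map_smul' := fun c x => by simp [star_smul] }

theorem dagger_apply (a : WithConv (H →ₗ[k] A)) (g : H) :
    dagger a g = star (a (star (antipode k g))) := rfl

theorem dagger_dagger (a : WithConv (H →ₗ[k] A)) : dagger (dagger a) = a := by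
  ext g
  rw [dagger_apply, dagger_apply, antipode_star', star_star, star_star]

/-- The expression `Δ(S(g)^*) = S(g₂)^* ⊗ S(g₁)^*`. -/
def starAntipodeRepr {g : H} {ι : Type*} (r : Repr k g ι) :
    Repr k (star (antipode k g)) ι where
  index := r.index
  left i := star (antipode k (r.right i))
  right i := star (antipode k (r.left i))
  eq := by
    rw [HopfStarAlgebra.comul_star, antipode_comul, ← r.eq]
    simp [star_sum]

theorem dagger_mul (a b : WithConv (H →ₗ[k] A)) : dagger (a * b) = dagger b * dagger a := by
  ext g
  rw [dagger_apply, (starAntipodeRepr (ℛ k g)).convMul_apply, (ℛ k g).convMul_apply, star_sum]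
  simp only [star_mul]
  rfl

theorem dagger_one : dagger (1 : WithConv (H →ₗ[k] A)) = 1 := by
  ext g
  rw [dagger_apply]
  simp only [LinearMap.convOne_apply, HopfStarAlgebra.counit_star, counit_antipode,
    algebraMap_star_comm, star_star]

theorem isUnitaryH_iff (a : WithConv (H →ₗ[k] A)) : IsUnitaryH a ↔ a * dagger a = 1 := by
  constructor
  · intro h
    ext g
    rw [(ℛ k g).convMul_apply]
    exact h g (ℛ k g)
  · intro h g ι r
    have := congrArg (fun f => f g) h
    simp only [r.convMul_apply] at this
    exact this

/-- The subgroup `U(H, A)` of `GL(H, A)` of those `a` with `a(g₁) a(S(g₂)^*)^* = ε(g) 1`. -/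
def UH (k : Type w) (H : Type v) (A : Type u) [CommRing k] [StarRing k] [Ring H]
    [HopfAlgebra k H] [StarRing H] [StarModule k H] [HopfStarAlgebra k H]
    [Ring A] [Algebra k A] [StarRing A] [StarModule k A] [HopfStarAction k H A] :
    Subgroup (GLH k H A) where
  carrier := {a | IsUnitaryH a.val}
  mul_mem' := by
    intro a b ha hb
    rw [Set.mem_ofPred_eq, isUnitaryH_iff] at *
    rw [GLH.coe_mul, dagger_mul, mul_assoc, ← mul_assoc b.val, hb, one_mul, ha]
  one_mem' := by
    rw [Set.mem_ofPred_eq, isUnitaryH_iff, GLH.coe_one, dagger_one, one_mul]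
  inv_mem' := by
    intro a ha
    rw [Set.mem_ofPred_eq, isUnitaryH_iff] at *
    have e : (a⁻¹).val * a.val = 1 := congrArg GLH.val (inv_mul_cancel a)
    have e1 : (a⁻¹).val = dagger a.val := by
      calc (a⁻¹).val = (a⁻¹).val * (a.val * dagger a.val) := by rw [ha, mul_one]
        _ = dagger a.val := by rw [← mul_assoc, e, one_mul]
    rw [e1, dagger_dagger, ← e1, e]

/-- The group `U(Z(A))` of central unitaries, as a subgroup of the group of central units. -/
def UZ (A : Type u) [Ring A] [StarRing A] : Subgroup (Subring.center A)ˣ where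
  carrier := {c | (c : A) ∈ unitary A}
  mul_mem' := fun ha hb => by simpa using mul_mem ha hb
  one_mem' := by simp
  inv_mem' := by
    intro c hc
    have e : ((c⁻¹ : (Subring.center A)ˣ) : A) = star (c : A) := by
      have e1 : ((c⁻¹ : (Subring.center A)ˣ) : A) * (c : A) = 1 := congrArg Subtype.val c.inv_mul
      calc ((c⁻¹ : (Subring.center A)ˣ) : A)
          = ((c⁻¹ : (Subring.center A)ˣ) : A) * ((c : A) * star (c : A)) := by
            rw [Unitary.mul_star_self_of_mem hc, mul_one]
        _ = _ := by rw [← mul_assoc, e1, one_mul]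
    rw [Set.mem_ofPred_eq, e]
    exact Unitary.star_mem hc

theorem UZ.coe_inv {c : (Subring.center A)ˣ} (hc : c ∈ UZ A) :
    ((c⁻¹ : (Subring.center A)ˣ) : A) = star (c : A) := by
  have e1 : ((c⁻¹ : (Subring.center A)ˣ) : A) * (c : A) = 1 := congrArg Subtype.val c.inv_mul
  calc ((c⁻¹ : (Subring.center A)ˣ) : A)
      = ((c⁻¹ : (Subring.center A)ˣ) : A) * ((c : A) * star (c : A)) := by
        rw [Unitary.mul_star_self_of_mem hc, mul_one]
    _ = _ := by rw [← mul_assoc, e1, one_mul]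

theorem hat_mem_UH {c : (Subring.center A)ˣ} (hc : c ∈ UZ A) : hatHom k H A c ∈ UH k H A := by
  intro g ι r
  have hc' : star (c : A) * (c : A) = 1 := Unitary.star_mul_self_of_mem hc
  have hc'' : (c : A) * star (c : A) = 1 := Unitary.mul_star_self_of_mem hc
  have e (h : H) : (c : A) * star ((hatHom k H A c).val (star (antipode k h))) = hact k h (c : A) := by
    change (c : A) * star (hact k (star (antipode k h)) ((c⁻¹ : (Subring.center A)ˣ) : A) * c) = _
    rw [star_mul, ← mul_assoc, hc'', one_mul, UZ.coe_inv hc]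
    refine (HopfStarAction.act_star _ _).trans ?_
    rw [antipode_star', star_star, star_star]
  have e2 (i : ι) : (hatHom k H A c).val (r.left i) *
      star ((hatHom k H A c).val (star (antipode k (r.right i)))) =
      hact k (r.left i) (star (c : A)) * hact k (r.right i) (c : A) := by
    rw [← e (r.right i), ← mul_assoc]
    congr 1
    change hact k (r.left i) ((c⁻¹ : (Subring.center A)ˣ) : A) * c = _
    rw [UZ.coe_inv hc]
  rw [Finset.sum_congr rfl fun i _ => e2 i]
  refine (HopfAction.act_mul g r (star (c : A)) (c : A)).symm.trans ?_
  rw [hc', HopfAction.act_one]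

/-- The group homomorphism `c ↦ ĉ` from `U(Z(A))` to `U(H, A)`. -/
def hatU (k : Type w) (H : Type v) (A : Type u) [CommRing k] [StarRing k] [Ring H]
    [HopfAlgebra k H] [StarRing H] [StarModule k H] [HopfStarAlgebra k H]
    [Ring A] [Algebra k A] [StarRing A] [StarModule k A] [HopfStarAction k H A] :
    UZ A →* UH k H A :=
  ((hatHom k H A).comp (UZ A).subtype).codRestrict (UH k H A) fun c => hat_mem_UH c.2

instance : (hatU k H A).range.Normal where
  conj_mem := by
    rintro _ ⟨c, rfl⟩ a
    refine ⟨c, Subtype.ext ?_⟩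
    change hatHom k H A c = (a : GLH k H A) * hatHom k H A c * (a : GLH k H A)⁻¹
    rw [hat_central, mul_inv_cancel_right]

/-- The group `U₀(H, A)`, the quotient of `U(H, A)` by the image of `U(Z(A))`. -/
abbrev U₀ (k : Type w) (H : Type v) (A : Type u) [CommRing k] [StarRing k] [Ring H]
    [HopfAlgebra k H] [StarRing H] [StarModule k H] [HopfStarAlgebra k H]
    [Ring A] [Algebra k A] [StarRing A] [StarModule k A] [HopfStarAction k H A] :
    Type (max u v) :=
  UH k H A ⧸ (hatU k H A).range

end StarGroups

/-! ### The ring-theoretic setting: bimodules, tensor products and Picard groupoids -/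

section Ring

open MulOpposite

/-- A `(B, A)`-bimodule over the unital `k`-algebras `B` and `A`: a `k`-module with a unital left
`B`-module structure `left b x = b · x` and a unital right `A`-module structure
`right (op a) x = x · a`, both compatible with the `k`-module structure. -/
structure Bimod (k : Type w) (B A : Type u) [CommRing k] [Ring B] [Algebra k B] [Ring A]
    [Algebra k A] where
  carrier : Type u
  [addCommGroup : AddCommGroup carrier]
  [module : Module k carrier]
  left : B →ₐ[k] Module.End k carrier
  right : Aᵐᵒᵖ →ₐ[k] Module.End k carrier
  left_right : ∀ (b : B) (x : carrier) (a : A),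
    left b (right (op a) x) = right (op a) (left b x)

attribute [instance] Bimod.addCommGroup Bimod.module

/-- An `H`-covariant `(B, A)`-bimodule: in addition, a left `H`-module structure `act` with
`g ▷ (b · x) = (g₁ ▷ b) · (g₂ ▷ x)` and `g ▷ (x · a) = (g₁ ▷ x) · (g₂ ▷ a)`. -/
structure HBimod (k : Type w) (H : Type v) (B A : Type u) [CommRing k] [Ring H] [HopfAlgebra k H]
    [Ring B] [Algebra k B] [HopfAction k H B] [Ring A] [Algebra k A] [HopfAction k H A]
    extends Bimod k B A where
  act : H →ₐ[k] Module.End k carrier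
  act_left : LeftCompat left act
  act_right : ∀ (g : H) {ι : Type v} (r : Repr k g ι) (x : carrier) (a : A),
    act g (right (op a) x) = ∑ i ∈ r.index, right (op (hact k (r.right i) a)) (act (r.left i) x)

namespace Bimod

variable {k : Type w} {C B A : Type u} [CommRing k] [Ring C] [Algebra k C] [Ring B] [Algebra k B]
  [Ring A] [Algebra k A]

/-- A linear bijection is an isomorphism of bimodules. -/
structure IsBimodIso (E F : Bimod k B A) (e : E.carrier ≃ₗ[k] F.carrier) : Prop where
  map_left : ∀ (b : B) (x : E.carrier), e (E.left b x) = F.left b (e x)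
  map_right : ∀ (a : A) (x : E.carrier), e (E.right (op a) x) = F.right (op a) (e x)

theorem IsBimodIso.refl (E : Bimod k B A) : IsBimodIso E E (LinearEquiv.refl k _) :=
  ⟨fun _ _ => rfl, fun _ _ => rfl⟩

theorem IsBimodIso.symm {E F : Bimod k B A} {e : E.carrier ≃ₗ[k] F.carrier}
    (h : IsBimodIso E F e) : IsBimodIso F E e.symm :=
  ⟨fun b x => by rw [LinearEquiv.symm_apply_eq, h.map_left, LinearEquiv.apply_symm_apply],
    fun a x => by rw [LinearEquiv.symm_apply_eq, h.map_right, LinearEquiv.apply_symm_apply]⟩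

theorem IsBimodIso.trans {E F G : Bimod k B A} {e : E.carrier ≃ₗ[k] F.carrier}
    {f : F.carrier ≃ₗ[k] G.carrier} (h : IsBimodIso E F e) (h' : IsBimodIso F G f) :
    IsBimodIso E G (e.trans f) :=
  ⟨fun b x => by simp [h.map_left, h'.map_left], fun a x => by simp [h.map_right, h'.map_right]⟩

/-- The submodule spanned by the elements `x · b ⊗ y - x ⊗ b · y`. -/
def balanced (E : Bimod k C B) (F : Bimod k B A) : Submodule k (E.carrier ⊗[k] F.carrier) :=
  Submodule.span k {z | ∃ (x : E.carrier) (b : B) (y : F.carrier),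
    z = E.right (op b) x ⊗ₜ[k] y - x ⊗ₜ[k] F.left b y}

/-- The tensor product `E ⊗_B F` over the (noncommutative) algebra `B`. -/
abbrev Tensor (E : Bimod k C B) (F : Bimod k B A) : Type u :=
  (E.carrier ⊗[k] F.carrier) ⧸ balanced E F

/-- The elementary tensor `x ⊗ y` in `E ⊗_B F`. -/
def tmul (E : Bimod k C B) (F : Bimod k B A) (x : E.carrier) (y : F.carrier) : Tensor E F :=
  (balanced E F).mkQ (x ⊗ₜ[k] y)

/-- A linear bijection `E ⊗_B F ≃ G` is an isomorphism of `(C, A)`-bimodules, where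
`c · (x ⊗ y) = (c · x) ⊗ y` and `(x ⊗ y) · a = x ⊗ (y · a)`. -/
structure IsTensorIso (E : Bimod k C B) (F : Bimod k B A) (G : Bimod k C A)
    (e : Tensor E F ≃ₗ[k] G.carrier) : Prop where
  map_left : ∀ c x y, e (tmul E F (E.left c x) y) = G.left c (e (tmul E F x y))
  map_right : ∀ a x y, e (tmul E F x (F.right (op a) y)) = G.right (op a) (e (tmul E F x y))

/-- The identity bimodule `A`. -/
abbrev regular (k : Type w) (A : Type u) [CommRing k] [Ring A] [Algebra k A] : Bimod k A A where
  carrier := A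
  left := Algebra.lmul k A
  right := Algebra.lsmul k k A
  left_right b x a := by simp [mul_assoc]

/-- `E` is an equivalence bimodule: it is invertible with respect to the tensor product. -/
def IsEquivalence (E : Bimod k B A) : Prop :=
  ∃ F : Bimod k A B,
    (∃ e, IsTensorIso E F (regular k B) e) ∧ (∃ e, IsTensorIso F E (regular k A) e)

end Bimod

namespace HBimod

variable {k : Type w} {H : Type v} {C B A : Type u} [CommRing k] [Ring H] [HopfAlgebra k H]
  [Ring C] [Algebra k C] [HopfAction k H C] [Ring B] [Algebra k B] [HopfAction k H B]
  [Ring A] [Algebra k A] [HopfAction k H A]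

/-- A linear bijection is an isomorphism of `H`-covariant bimodules. -/
structure IsHBimodIso (E F : HBimod k H B A) (e : E.carrier ≃ₗ[k] F.carrier) : Prop extends
    Bimod.IsBimodIso E.toBimod F.toBimod e where
  map_act : ∀ (g : H) (x : E.carrier), e (E.act g x) = F.act g (e x)

/-- A linear bijection `E ⊗_B F ≃ G` is an isomorphism of `H`-covariant bimodules, where
`g ▷ (x ⊗ y) = (g₁ ▷ x) ⊗ (g₂ ▷ y)`. -/
structure IsHTensorIso (E : HBimod k H C B) (F : HBimod k H B A) (G : HBimod k H C A)
    (e : Bimod.Tensor E.toBimod F.toBimod ≃ₗ[k] G.carrier) : Prop extends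
    Bimod.IsTensorIso E.toBimod F.toBimod G.toBimod e where
  map_act : ∀ (g : H) {ι : Type v} (r : Repr k g ι) x y,
    e (∑ i ∈ r.index, Bimod.tmul E.toBimod F.toBimod (E.act (r.left i) x) (F.act (r.right i) y)) =
      G.act g (e (Bimod.tmul E.toBimod F.toBimod x y))

/-- The identity bimodule `A` with the given action of `H`. -/
abbrev regular (k : Type w) (H : Type v) (A : Type u) [CommRing k] [Ring H] [HopfAlgebra k H]
    [Ring A] [Algebra k A] [HopfAction k H A] : HBimod k H A A where
  toBimod := Bimod.regular k A
  act := (HopfAction.act : H →ₐ[k] Module.End k A)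
  act_left := leftCompat_self (A := A)
  act_right g _ r x a := HopfAction.act_mul (A := A) g r x a

/-- `E` is an `H`-covariant equivalence bimodule: it is invertible with respect to the tensor
product of `H`-covariant bimodules. -/
def IsEquivalence (E : HBimod k H B A) : Prop :=
  ∃ F : HBimod k H A B,
    (∃ e, IsHTensorIso E F (regular k H B) e) ∧ (∃ e, IsHTensorIso F E (regular k H A) e)

theorem IsEquivalence.toBimod {E : HBimod k H B A} (h : E.IsEquivalence) :
    E.toBimod.IsEquivalence := by
  obtain ⟨F, ⟨e, he⟩, ⟨f, hf⟩⟩ := h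
  exact ⟨F.toBimod, ⟨e, he.toIsTensorIso⟩, ⟨f, hf.toIsTensorIso⟩⟩

/-- The bimodule `E` with the action `g ▷ᵃ x = a(g₁) · (g₂ ▷ x)` for `a` in `GL(H, B)`. -/
def twist (a : GLH k H B) (E : HBimod k H B A) : HBimod k H B A where
  toBimod := E.toBimod
  act := twistAct E.left E.act E.act_left a.val a.isGL
  act_left := twist_leftCompat E.act_left a.isGL
  act_right := twist_right E.act_left a.isGL E.right E.left_right E.act_right

end HBimod

end Ring

section RingPic

variable (k : Type w) (H : Type v) (B A : Type u) [CommRing k] [Ring H] [HopfAlgebra k H]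
  [Ring B] [Algebra k B] [Ring A] [Algebra k A]

/-- Isomorphism of bimodules. -/
def bimodSetoid : Setoid (Bimod k B A) where
  r E F := ∃ e, Bimod.IsBimodIso E F e
  iseqv := ⟨fun E => ⟨_, .refl E⟩, fun ⟨_, h⟩ => ⟨_, h.symm⟩, fun ⟨_, h⟩ ⟨_, h'⟩ => ⟨_, h.trans h'⟩⟩

/-- The equivalence bimodules between `B` and `A`. -/
abbrev EqBimod : Type _ := {E : Bimod k B A // E.IsEquivalence}

/-- `Pic(B, A)`: the isomorphism classes of equivalence bimodules. -/
abbrev Pic : Type _ := Quotient ((bimodSetoid k B A).comap (Subtype.val : EqBimod k B A → _))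

variable [HopfAction k H B] [HopfAction k H A]

/-- Isomorphism of `H`-covariant bimodules. -/
def hbimodSetoid : Setoid (HBimod k H B A) where
  r E F := ∃ e, HBimod.IsHBimodIso E F e
  iseqv := ⟨fun E => ⟨LinearEquiv.refl k _, .refl _, fun _ _ => rfl⟩,
    fun ⟨e, h⟩ => ⟨e.symm, h.toIsBimodIso.symm, fun g x => by
      rw [LinearEquiv.symm_apply_eq, h.map_act, LinearEquiv.apply_symm_apply]⟩,
    fun ⟨e, h⟩ ⟨f, h'⟩ => ⟨e.trans f, h.toIsBimodIso.trans h'.toIsBimodIso, fun g x => by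
      simp [h.map_act, h'.map_act]⟩⟩

/-- The `H`-covariant equivalence bimodules between `B` and `A`. -/
abbrev EqHBimod : Type _ := {E : HBimod k H B A // E.IsEquivalence}

/-- `Pic_H(B, A)`: the isomorphism classes of `H`-covariant equivalence bimodules. -/
abbrev PicH : Type _ :=
  Quotient ((hbimodSetoid k H B A).comap (Subtype.val : EqHBimod k H B A → _))

/-- The map `Pic_H(B, A) → Pic(B, A)` forgetting the action of `H`. -/
def forgetPic : PicH k H B A → Pic k B A :=
  Quotient.map (fun E => ⟨E.1.toBimod, E.2.toBimod⟩) fun _ _ ⟨e, h⟩ => ⟨e, h.toIsBimodIso⟩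

end RingPic

/-! ### The `*`-setting: inner product bimodules, internal tensor products, Picard groupoids -/

section Star

open MulOpposite

/-- A `*`-representation of `B` on an inner product right `A`-module: a bimodule with an
`A`-valued inner product which is linear in the second argument, Hermitian, right `A`-linear in the
second argument and non-degenerate, such that `b ∈ B` acts by an adjointable operator with adjoint
the action of `b^*`. -/
structure InnerBimod (k : Type w) (B A : Type u) [CommRing k] [StarRing k] [Ring B] [Algebra k B]
    [StarRing B] [Ring A] [Algebra k A] [StarRing A] extends Bimod k B A where
  inner : carrier → carrier →ₗ[k] A
  inner_symm : ∀ x y, inner x y = star (inner y x)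
  inner_right : ∀ x y a, inner x (right (op a) y) = inner x y * a
  inner_nondeg : ∀ x, (∀ y, inner y x = 0) → x = 0
  inner_left : ∀ x b y, inner x (left b y) = inner (left (star b) x) y

/-- An `H`-covariant `*`-representation of `B` on an inner product right `A`-module: in addition, a
left `H`-module structure `act` with `g ▷ ⟨x, y⟩ = ⟨S(g₁)^* ▷ x, g₂ ▷ y⟩` and
`g ▷ (b · x) = (g₁ ▷ b) · (g₂ ▷ x)`; then `g ▷ (x · a) = (g₁ ▷ x) · (g₂ ▷ a)` holds by
non-degeneracy. -/
structure HInnerBimod (k : Type w) (H : Type v) (B A : Type u) [CommRing k] [StarRing k] [Ring H]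
    [HopfAlgebra k H] [StarRing H] [StarModule k H] [Ring B] [Algebra k B] [StarRing B]
    [StarModule k B] [HopfStarAction k H B] [Ring A] [Algebra k A] [StarRing A] [StarModule k A]
    [HopfStarAction k H A] extends InnerBimod k B A where
  act : H →ₐ[k] Module.End k carrier
  act_inner : ∀ (g : H) {ι : Type v} (r : Repr k g ι) (x y : carrier),
    hact k g (inner x y) =
      ∑ i ∈ r.index, inner (act (star (antipode k (r.left i))) x) (act (r.right i) y)
  act_left : LeftCompat left act

namespace InnerBimod

variable {k : Type w} {C B A : Type u} [CommRing k] [StarRing k] [Ring C] [Algebra k C]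
  [StarRing C] [Ring B] [Algebra k B] [StarRing B] [Ring A] [Algebra k A] [StarRing A]

/-- A linear bijection is an isometric isomorphism of inner product bimodules. -/
structure IsIsometricIso (E F : InnerBimod k B A) (e : E.carrier ≃ₗ[k] F.carrier) : Prop extends
    Bimod.IsBimodIso E.toBimod F.toBimod e where
  map_inner : ∀ x y, F.inner (e x) (e y) = E.inner x y

/-- Rieffel's inner product with an elementary tensor: the map
`x' ⊗ y' ↦ ⟨x ⊗ y, x' ⊗ y'⟩ = ⟨y, ⟨x, x'⟩ · y'⟩` on `E ⊗_B F`. -/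
def rieffel (E : InnerBimod k C B) (F : InnerBimod k B A) (x : E.carrier) (y : F.carrier) :
    Bimod.Tensor E.toBimod F.toBimod →ₗ[k] A :=
  (Bimod.balanced E.toBimod F.toBimod).liftQ
    (TensorProduct.lift ((F.left.toLinearMap ∘ₗ E.inner x).compr₂ (F.inner y)))
    (by
      rw [Bimod.balanced, Submodule.span_le]
      rintro _ ⟨x', b, y', rfl⟩
      simp [E.inner_right])

@[simp] theorem rieffel_tmul (E : InnerBimod k C B) (F : InnerBimod k B A) (x x' : E.carrier)
    (y y' : F.carrier) :
    rieffel E F x y (Bimod.tmul E.toBimod F.toBimod x' y') =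
      F.inner y (F.left (E.inner x x') y') := rfl

/-- The degeneracy space `(E ⊗_B F)^⊥` of Rieffel's inner product; since elementary tensors span,
it suffices to test against these. -/
def degeneracy (E : InnerBimod k C B) (F : InnerBimod k B A) :
    Submodule k (Bimod.Tensor E.toBimod F.toBimod) :=
  ⨅ (x : E.carrier) (y : F.carrier), LinearMap.ker (rieffel E F x y)

/-- The internal tensor product `(E ⊗_B F) / (E ⊗_B F)^⊥`. -/
abbrev InnerTensor (E : InnerBimod k C B) (F : InnerBimod k B A) : Type u :=
  Bimod.Tensor E.toBimod F.toBimod ⧸ degeneracy E F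

/-- The class of the elementary tensor `x ⊗ y` in the internal tensor product. -/
def tmul (E : InnerBimod k C B) (F : InnerBimod k B A) (x : E.carrier) (y : F.carrier) :
    InnerTensor E F :=
  (degeneracy E F).mkQ (Bimod.tmul E.toBimod F.toBimod x y)

/-- A linear bijection from the internal tensor product of `E` and `F` to `G` is an isometric
isomorphism of inner product bimodules, where `c · (x ⊗ y) = (c · x) ⊗ y`,
`(x ⊗ y) · a = x ⊗ (y · a)` and `⟨x ⊗ y, x' ⊗ y'⟩ = ⟨y, ⟨x, x'⟩ · y'⟩`. -/
structure IsInnerTensorIso (E : InnerBimod k C B) (F : InnerBimod k B A) (G : InnerBimod k C A)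
    (e : InnerTensor E F ≃ₗ[k] G.carrier) : Prop where
  map_left : ∀ c x y, e (tmul E F (E.left c x) y) = G.left c (e (tmul E F x y))
  map_right : ∀ a x y, e (tmul E F x (F.right (op a) y)) = G.right (op a) (e (tmul E F x y))
  map_inner : ∀ x y x' y', G.inner (e (tmul E F x y)) (e (tmul E F x' y')) =
    F.inner y (F.left (E.inner x x') y')

/-- The identity bimodule `A` with inner product `⟨a, b⟩ = a^* b`. -/
abbrev regular (k : Type w) (A : Type u) [CommRing k] [StarRing k] [Ring A] [Algebra k A]
    [StarRing A] : InnerBimod k A A where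
  toBimod := Bimod.regular k A
  inner := fun a : A => LinearMap.mulLeft k (star a)
  inner_symm := fun (x y : A) => (by rw [star_mul, star_star] : star x * y = star (star y * x))
  inner_right := fun (x y a : A) => (mul_assoc (star x) y a).symm
  inner_nondeg := fun (x : A) (h : ∀ y : A, star y * x = 0) => (by simpa using h 1 : x = 0)
  inner_left := fun (x b y : A) =>
    (by rw [star_mul, star_star, mul_assoc] : star x * (b * y) = star (star b * x) * y)

/-- `E` is a `*`-equivalence bimodule: it is invertible with respect to the internal tensor
product. -/
def IsStarEquivalence (E : InnerBimod k B A) : Prop :=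
  ∃ F : InnerBimod k A B,
    (∃ e, IsInnerTensorIso E F (regular k B) e) ∧ (∃ e, IsInnerTensorIso F E (regular k A) e)

end InnerBimod

namespace HInnerBimod

variable {k : Type w} {H : Type v} {C B A : Type u} [CommRing k] [StarRing k] [Ring H]
  [HopfAlgebra k H] [StarRing H] [StarModule k H] [Ring C] [Algebra k C] [StarRing C]
  [StarModule k C] [HopfStarAction k H C] [Ring B] [Algebra k B] [StarRing B] [StarModule k B]
  [HopfStarAction k H B] [Ring A] [Algebra k A] [StarRing A] [StarModule k A]
  [HopfStarAction k H A]

/-- A linear bijection is an isometric isomorphism of `H`-covariant inner product bimodules. -/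
structure IsHIsometricIso (E F : HInnerBimod k H B A) (e : E.carrier ≃ₗ[k] F.carrier) : Prop
    extends InnerBimod.IsIsometricIso E.toInnerBimod F.toInnerBimod e where
  map_act : ∀ (g : H) (x : E.carrier), e (E.act g x) = F.act g (e x)

/-- A linear bijection from the internal tensor product of `E` and `F` to `G` is an isometric
isomorphism of `H`-covariant bimodules, where `g ▷ (x ⊗ y) = (g₁ ▷ x) ⊗ (g₂ ▷ y)`. -/
structure IsHInnerTensorIso (E : HInnerBimod k H C B) (F : HInnerBimod k H B A)
    (G : HInnerBimod k H C A)
    (e : InnerBimod.InnerTensor E.toInnerBimod F.toInnerBimod ≃ₗ[k] G.carrier) : Prop extends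
    InnerBimod.IsInnerTensorIso E.toInnerBimod F.toInnerBimod G.toInnerBimod e where
  map_act : ∀ (g : H) {ι : Type v} (r : Repr k g ι) x y,
    e (∑ i ∈ r.index, InnerBimod.tmul E.toInnerBimod F.toInnerBimod
        (E.act (r.left i) x) (F.act (r.right i) y)) =
      G.act g (e (InnerBimod.tmul E.toInnerBimod F.toInnerBimod x y))

/-- The identity bimodule `A` with inner product `⟨a, b⟩ = a^* b` and the given action of `H`. -/
abbrev regular (k : Type w) (H : Type v) (A : Type u) [CommRing k] [StarRing k] [Ring H]
    [HopfAlgebra k H] [StarRing H] [StarModule k H] [HopfStarAlgebra k H] [Ring A] [Algebra k A]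
    [StarRing A] [StarModule k A] [HopfStarAction k H A] : HInnerBimod k H A A where
  toInnerBimod := InnerBimod.regular k A
  act := (HopfAction.act : H →ₐ[k] Module.End k A)
  act_inner := fun g _ r (x y : A) =>
    ((HopfAction.act_mul g r (star x) y).trans (Finset.sum_congr rfl fun i _ => by
      congr 1
      refine Eq.symm ((HopfStarAction.act_star _ _).trans ?_)
      rw [antipode_star', star_star]) :
        hact k g (star x * y) = ∑ i ∈ r.index,
          star (hact k (star (antipode k (r.left i))) x) * hact k (r.right i) y)
  act_left := leftCompat_self (A := A)

/-- `E` is an `H`-covariant `*`-equivalence bimodule: it is invertible with respect to the internal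
tensor product of `H`-covariant bimodules. -/
def IsStarEquivalence [HopfStarAlgebra k H] (E : HInnerBimod k H B A) : Prop :=
  ∃ F : HInnerBimod k H A B,
    (∃ e, IsHInnerTensorIso E F (regular k H B) e) ∧
      (∃ e, IsHInnerTensorIso F E (regular k H A) e)

theorem IsStarEquivalence.toInnerBimod [HopfStarAlgebra k H] {E : HInnerBimod k H B A}
    (h : E.IsStarEquivalence) : E.toInnerBimod.IsStarEquivalence := by
  obtain ⟨F, ⟨e, he⟩, ⟨f, hf⟩⟩ := h
  exact ⟨F.toInnerBimod, ⟨e, he.toIsInnerTensorIso⟩, ⟨f, hf.toIsInnerTensorIso⟩⟩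

theorem inner_add_left (E : InnerBimod k B A) (x x' y : E.carrier) :
    E.inner (x + x') y = E.inner x y + E.inner x' y := by
  rw [E.inner_symm, map_add, star_add, ← E.inner_symm, ← E.inner_symm]

theorem inner_smul_left (E : InnerBimod k B A) (c : k) (x y : E.carrier) :
    E.inner (c • x) y = star c • E.inner x y := by
  rw [E.inner_symm, map_smul, star_smul, ← E.inner_symm]

theorem inner_sum_left (E : InnerBimod k B A) {ι : Type*} (s : Finset ι) (x : ι → E.carrier)
    (y : E.carrier) : E.inner (∑ i ∈ s, x i) y = ∑ i ∈ s, E.inner (x i) y := by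
  rw [E.inner_symm, map_sum, star_sum]
  exact Finset.sum_congr rfl fun i _ => (E.inner_symm _ _).symm

/-- The linear map `g ↦ ⟨S(g)^* ▷ x, -⟩`. -/
def innerAct (E : HInnerBimod k H B A) (x : E.carrier) : H →ₗ[k] E.carrier →ₗ[k] A where
  toFun g := E.inner (E.act (star (antipode k g)) x)
  map_add' g g' := by
    ext y
    simp [inner_add_left]
  map_smul' c g := by
    ext y
    simp [inner_smul_left, star_smul]

theorem twist_inner [HopfStarAlgebra k H] (a : UH k H B) (E : HInnerBimod k H B A) (g : H)
    {ι : Type v} (r : Repr k g ι) (x y : E.carrier) :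
    hact k g (E.inner x y) = ∑ i ∈ r.index,
      E.inner (twistAct E.left E.act E.act_left a.1.val a.1.isGL (star (antipode k (r.left i))) x)
        (twistAct E.left E.act E.act_left a.1.val a.1.isGL (r.right i) y) := by
  let γ : (E.carrier →ₗ[k] A) →ₗ[k] E.carrier →ₗ[k] A := LinearMap.id
  let κ : (E.carrier →ₗ[k] A) →ₗ[k] B →ₗ[k] (E.carrier →ₗ[k] A) :=
    (LinearMap.llcomp k E.carrier E.carrier A).compl₂ E.left.toLinearMap
  let μ : B →ₗ[k] E.carrier →ₗ[k] E.carrier := E.left.toLinearMap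
  let P := innerAct E x
  let Y : H →ₗ[k] E.carrier := E.act.toLinearMap.flip y
  let α : H →ₗ[k] B := a.1.val.ofConv
  let α' : H →ₗ[k] B := (dagger a.1.val).ofConv
  have hα : dagger a.1.val * a.1.val = 1 := by
    have h1 := (isUnitaryH_iff a.1.val).mp a.2
    have h2 : (a.1⁻¹).val * a.1.val = 1 := congrArg GLH.val (inv_mul_cancel a.1)
    rwa [left_inv_eq_right_inv h2 h1] at h2
  have e1 (g : H) : sw κ P α' g =
      E.inner (twistAct E.left E.act E.act_left a.1.val a.1.isGL (star (antipode k g)) x) := by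
    ext z
    rw [sw_apply _ _ _ (ℛ k g), twistAct_apply _ _ (starAntipodeRepr (ℛ k g)), inner_sum_left,
      LinearMap.sum_apply]
    refine Finset.sum_congr rfl fun i _ => ?_
    change E.inner _ (E.left (star _) z) = _
    rw [E.inner_left, star_star]
    rfl
  have e2 (g : H) : sw μ α Y g = twistAct E.left E.act E.act_left a.1.val a.1.isGL g y := by
    rw [sw_apply _ _ _ (ℛ k g), twistAct_apply _ _ (ℛ k g)]
    rfl
  have e3 : sw μ α' (sw μ α Y) = Y := by
    rw [← sw_assoc (LinearMap.mul k B) μ μ μ (fun b b' z => by simp [μ])]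
    have : sw (LinearMap.mul k B) α' α = (1 : WithConv (H →ₗ[k] B)).ofConv := by
      rw [← hα]
      rfl
    rw [this]
    ext h
    rw [sw_apply _ _ _ (ℛ k h)]
    conv_rhs => rw [← sum_counit_smul (ℛ k h)]
    simp [μ, Y, Algebra.algebraMap_eq_smul_one]
  have e4 : sw γ (sw κ P α') (sw μ α Y) = sw γ P Y := by
    rw [sw_assoc κ γ μ γ (fun p b z => rfl), e3]
  have e5 := congrArg (fun f => f g) e4
  simp only [sw_apply _ _ _ r, e1, e2] at e5
  rw [E.act_inner g r]
  exact e5.symm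

/-- The bimodule `E` with the same inner product and the action `g ▷ᵃ x = a(g₁) · (g₂ ▷ x)` for
`a` in `U(H, B)`. -/
def twist [HopfStarAlgebra k H] (a : UH k H B) (E : HInnerBimod k H B A) :
    HInnerBimod k H B A where
  toInnerBimod := E.toInnerBimod
  act := twistAct E.left E.act E.act_left a.1.val a.1.isGL
  act_inner := twist_inner a E
  act_left := twist_leftCompat E.act_left a.1.isGL

end HInnerBimod

end Star

section StarPic

variable (k : Type w) (H : Type v) (B A : Type u) [CommRing k] [StarRing k] [Ring H]
  [HopfAlgebra k H] [StarRing H] [StarModule k H] [HopfStarAlgebra k H] [Ring B] [Algebra k B]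
  [StarRing B] [Ring A] [Algebra k A] [StarRing A]

/-- Isometric isomorphism of inner product bimodules. -/
def innerSetoid : Setoid (InnerBimod k B A) where
  r E F := ∃ e, InnerBimod.IsIsometricIso E F e
  iseqv := ⟨fun E => ⟨LinearEquiv.refl k _, .refl _, fun _ _ => rfl⟩,
    fun ⟨e, h⟩ => ⟨e.symm, h.toIsBimodIso.symm, fun x y => by rw [← h.map_inner]; simp⟩,
    fun ⟨e, h⟩ ⟨f, h'⟩ => ⟨e.trans f, h.toIsBimodIso.trans h'.toIsBimodIso, fun x y => by
      simp [h.map_inner, h'.map_inner]⟩⟩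

/-- The `*`-equivalence bimodules. -/
abbrev StarEqBimod : Type _ := {E : InnerBimod k B A // E.IsStarEquivalence}

/-- `Pic^*(B, A)`: the isometric isomorphism classes of `*`-equivalence bimodules. -/
abbrev StarPic : Type _ :=
  Quotient ((innerSetoid k B A).comap (Subtype.val : StarEqBimod k B A → _))

variable [StarModule k B] [HopfStarAction k H B] [StarModule k A] [HopfStarAction k H A]

/-- Isometric isomorphism of `H`-covariant inner product bimodules. -/
def hinnerSetoid : Setoid (HInnerBimod k H B A) where
  r E F := ∃ e, HInnerBimod.IsHIsometricIso E F e
  iseqv := ⟨fun E => ⟨LinearEquiv.refl k _, ⟨.refl _, fun _ _ => rfl⟩, fun _ _ => rfl⟩,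
    fun ⟨e, h⟩ => ⟨e.symm, ⟨h.toIsBimodIso.symm, fun x y => by rw [← h.map_inner]; simp⟩,
      fun g x => by rw [LinearEquiv.symm_apply_eq, h.map_act, LinearEquiv.apply_symm_apply]⟩,
    fun ⟨e, h⟩ ⟨f, h'⟩ => ⟨e.trans f, ⟨h.toIsBimodIso.trans h'.toIsBimodIso, fun x y => by
      simp [h.map_inner, h'.map_inner]⟩, fun g x => by simp [h.map_act, h'.map_act]⟩⟩

/-- The `H`-covariant `*`-equivalence bimodules. -/
abbrev StarEqHBimod : Type _ := {E : HInnerBimod k H B A // E.IsStarEquivalence}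

/-- `Pic^*_H(B, A)`: the isometric isomorphism classes of `H`-covariant `*`-equivalence
bimodules. -/
abbrev StarPicH : Type _ :=
  Quotient ((hinnerSetoid k H B A).comap (Subtype.val : StarEqHBimod k H B A → _))

/-- The map `Pic^*_H(B, A) → Pic^*(B, A)` forgetting the action of `H`. -/
def forgetStarPic : StarPicH k H B A → StarPic k B A :=
  Quotient.map (fun E => ⟨E.1.toInnerBimod, E.2.toInnerBimod⟩)
    fun _ _ ⟨e, h⟩ => ⟨e, h.toIsIsometricIso⟩

end StarPic

/-! ### Complete positivity and strong Picard groupoids -/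

section Strong

/-- `0 ≤ z` in `R(i)`: `z` lies in `R` and is nonnegative there. -/
def IsNonneg {R : Type w} [CommRing R] [LinearOrder R] (z : Cx R) : Prop :=
  0 ≤ z.re ∧ z.im = 0

/-- A linear functional with `ω(a^* a) ≥ 0` for all `a`. -/
def IsPositiveFunctional {R : Type w} [CommRing R] [LinearOrder R] {A : Type u} [Ring A]
    [Algebra (Cx R) A] [StarRing A] (ω : A →ₗ[Cx R] Cx R) : Prop :=
  ∀ a : A, IsNonneg (ω (star a * a))

/-- A positive algebra element: `ω(a) ≥ 0` for all positive functionals `ω`. -/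
def IsPositiveElement (R : Type w) [CommRing R] [LinearOrder R] {A : Type u} [Ring A]
    [Algebra (Cx R) A] [StarRing A] (a : A) : Prop :=
  ∀ ω : A →ₗ[Cx R] Cx R, IsPositiveFunctional ω → IsNonneg (ω a)

variable {R : Type w} {H : Type v} {B A : Type u} [CommRing R] [LinearOrder R]
  [IsStrictOrderedRing R] [Ring H] [HopfAlgebra (Cx R) H] [StarRing H] [StarModule (Cx R) H]
  [HopfStarAlgebra (Cx R) H] [Ring B] [Algebra (Cx R) B] [StarRing B] [Ring A]
  [Algebra (Cx R) A] [StarRing A]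

/-- The inner product is completely positive: all matrices `(⟨xᵢ, xⱼ⟩)` are positive elements of
the `*`-algebra `Mₙ(A)`. -/
def InnerBimod.IsCompletelyPositive (E : InnerBimod (Cx R) B A) : Prop :=
  ∀ (n : ℕ) (x : Fin n → E.carrier),
    IsPositiveElement R (Matrix.of fun i j => E.inner (x i) (x j))

/-- `E` is a strong equivalence bimodule: its inner product is completely positive, and it is
invertible with respect to the internal tensor product among bimodules with completely positive
inner products. -/
def InnerBimod.IsStrongEquivalence (E : InnerBimod (Cx R) B A) : Prop :=
  E.IsCompletelyPositive ∧ ∃ F : InnerBimod (Cx R) A B, F.IsCompletelyPositive ∧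
    (∃ e, IsInnerTensorIso E F (regular (Cx R) B) e) ∧
      (∃ e, IsInnerTensorIso F E (regular (Cx R) A) e)

variable [StarModule (Cx R) B] [HopfStarAction (Cx R) H B] [StarModule (Cx R) A]
  [HopfStarAction (Cx R) H A]

/-- `E` is an `H`-covariant strong equivalence bimodule. -/
def HInnerBimod.IsStrongEquivalence (E : HInnerBimod (Cx R) H B A) : Prop :=
  E.IsCompletelyPositive ∧ ∃ F : HInnerBimod (Cx R) H A B, F.IsCompletelyPositive ∧
    (∃ e, IsHInnerTensorIso E F (regular (Cx R) H B) e) ∧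
      (∃ e, IsHInnerTensorIso F E (regular (Cx R) H A) e)

theorem HInnerBimod.IsStrongEquivalence.toInnerBimod {E : HInnerBimod (Cx R) H B A}
    (h : E.IsStrongEquivalence) : E.toInnerBimod.IsStrongEquivalence := by
  obtain ⟨hE, F, hF, ⟨e, he⟩, ⟨f, hf⟩⟩ := h
  exact ⟨hE, F.toInnerBimod, hF, ⟨e, he.toIsInnerTensorIso⟩, ⟨f, hf.toIsInnerTensorIso⟩⟩

end Strong

section StrongPic

variable (R : Type w) (H : Type v) (B A : Type u) [CommRing R] [LinearOrder R]
  [IsStrictOrderedRing R] [Ring H] [HopfAlgebra (Cx R) H] [StarRing H] [StarModule (Cx R) H]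
  [HopfStarAlgebra (Cx R) H] [Ring B] [Algebra (Cx R) B] [StarRing B] [Ring A]
  [Algebra (Cx R) A] [StarRing A]

/-- The strong equivalence bimodules. -/
abbrev StrEqBimod : Type _ := {E : InnerBimod (Cx R) B A // E.IsStrongEquivalence}

/-- `Pic^str(B, A)`: the isometric isomorphism classes of strong equivalence bimodules. -/
abbrev StrPic : Type _ :=
  Quotient ((innerSetoid (Cx R) B A).comap (Subtype.val : StrEqBimod R B A → _))

variable [StarModule (Cx R) B] [HopfStarAction (Cx R) H B] [StarModule (Cx R) A]
  [HopfStarAction (Cx R) H A]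

/-- The `H`-covariant strong equivalence bimodules. -/
abbrev StrEqHBimod : Type _ := {E : HInnerBimod (Cx R) H B A // E.IsStrongEquivalence}

/-- `Pic^str_H(B, A)`: the isometric isomorphism classes of `H`-covariant strong equivalence
bimodules. -/
abbrev StrPicH : Type _ :=
  Quotient ((hinnerSetoid (Cx R) H B A).comap (Subtype.val : StrEqHBimod R H B A → _))

/-- The map `Pic^str_H(B, A) → Pic^str(B, A)` forgetting the action of `H`. -/
def forgetStrPic : StrPicH R H B A → StrPic R B A :=
  Quotient.map (fun E => ⟨E.1.toInnerBimod, E.2.toInnerBimod⟩)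
    fun _ _ ⟨e, h⟩ => ⟨e, h.toIsIsometricIso⟩

end StrongPic

/-- `π : X → Y` is a principal `G`-bundle: it is onto, `G` preserves its fibres, and `G` acts freely
and transitively on every fibre. -/
structure IsPrincipalBundle (G : Type*) {X Y : Type*} [Group G] [MulAction G X] (π : X → Y) :
    Prop where
  surjective : Function.Surjective π
  invariant : ∀ (g : G) (x : X), π (g • x) = π x
  free : ∀ (g : G) (x : X), g • x = x → g = 1
  transitive : ∀ x y : X, π x = π y → ∃ g : G, g • x = y

end

end HopfMorita

universe u v w

open HopfMorita

/-!
The forgetful map is invariant under twisting, so the statement amounts to four facts about an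
invertible `H`-covariant bimodule `E`: twists of `E` are invertible, twisting by `ĉ` gives a bimodule
isomorphic to `E`, these are the only twists isomorphic to `E`, and any two actions of `H` on the
bimodule `E` differ by a twist. Everything else is formal
(`exists_mulAction_isPrincipalBundle`).

The algebraic input is that the right `A`-linear endomorphisms of `E` are exactly the left
multiplications by elements of `B` (`Bimod.IsEquivalence.isLeftFull`). In the `*`-setting this follows
from the ring-theoretic case, because an invertible inner product bimodule has a finite dual basis,
so that the inner product on the tensor product with its inverse is already non-degenerate
(`InnerBimod.IsStarEquivalence.toBimod`).

* If `F` is an inverse of `E`, then `F` with the action `(g, y) ↦ (g₁ ▷ y) · a⁻¹(g₂)` is an inverse of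
  the twist of `E` by `a` (`sw_twist_rightTwist`, `sw_rightTwist_twist`). The bimodules and inner
  products are unchanged, hence complete positivity is preserved.
* An isomorphism from the twist of `E` by `a` to `E` is a bimodule automorphism of `E`, hence the
  multiplication by a central unit `c`; equivariance says `c a(g) = g ▷ c`, that is, `a` belongs to
  `c⁻¹`. It is isometric if and only if `c` is unitary.
* Given two actions `▷` and `▷'` on `E`, the maps `x ↦ g₁ ▷' (S(g₂) ▷ x)` are right `A`-linear
  (`quotLin_right`), hence the left multiplications by elements `a(g)`; then `a` lies in `GL(H, B)`
  and `▷'` is the twist of `▷` by `a` (`exists_twistAct_eq`). If both actions are compatible with an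
  inner product, then `a` is unitary (`HInnerBimod.mem_UH_of_twist_inner`).

In an inner product bimodule the compatibility of the action of `H` with the right multiplication
follows from non-degeneracy, by a cancellation in Sweedler sums (`HInnerBimod.inner_cancel`).
-/

namespace HopfMorita

open Coalgebra HopfAlgebra WithConv MulOpposite

set_option linter.unusedSectionVars false

/-! ### Principal bundles of isomorphism classes -/

/-- A family `tw` of operations on objects which satisfies the axioms of an action up to
isomorphism, and for which `N` is the stabilizer of every object, makes the isomorphism classes a
principal `G ⧸ N`-bundle over the image of any invariant map whose fibres are the orbits. -/
theorem exists_mulAction_isPrincipalBundle {X Y G : Type*} [s : Setoid X] [Group G]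
    (N : Subgroup G) [N.Normal] (tw : G → X → X) (π : Quotient s → Y)
    (one : ∀ x, tw 1 x ≈ x) (mul : ∀ g h x, tw (g * h) x ≈ tw g (tw h x))
    (congr : ∀ g x y, x ≈ y → tw g x ≈ tw g y) (triv : ∀ n ∈ N, ∀ x, tw n x ≈ x)
    (inv : ∀ g x, π ⟦tw g x⟧ = π ⟦x⟧) (free : ∀ g x, tw g x ≈ x → g ∈ N)
    (trans : ∀ x y, π ⟦x⟧ = π ⟦y⟧ → ∃ g, tw g x ≈ y) :
    ∃ _ : MulAction (G ⧸ N) (Quotient s),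
      (∀ (g : G) (x : X), (QuotientGroup.mk g : G ⧸ N) • (⟦x⟧ : Quotient s) = ⟦tw g x⟧) ∧
      IsPrincipalBundle (G ⧸ N) (Set.rangeFactorization π) := by
  let op (g : G) : Quotient s → Quotient s := Quotient.map (tw g) (congr g)
  have op_mul (g h : G) (q : Quotient s) : op (g * h) q = op g (op h q) := by
    induction q using Quotient.inductionOn with | _ x => exact Quotient.sound (mul g h x)
  have op_congr (g h : G) (e : QuotientGroup.leftRel N g h) : op g = op h := by
    rw [QuotientGroup.leftRel_apply] at e
    funext q
    obtain ⟨n, hn, rfl⟩ : ∃ n ∈ N, h = g * n := ⟨_, e, by group⟩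
    rw [op_mul]
    congr 1
    induction q using Quotient.inductionOn with
    | _ x => exact (Quotient.sound (triv n hn x)).symm
  let act : MulAction (G ⧸ N) (Quotient s) :=
    { smul := fun g q => Quotient.liftOn' g (fun g => op g q) fun g h e => congrFun (op_congr g h e) q
      one_smul := fun q => by
        induction q using Quotient.inductionOn with | _ x => exact Quotient.sound (one x)
      mul_smul := fun g h q => by
        induction g using QuotientGroup.induction_on with | _ g =>
        induction h using QuotientGroup.induction_on with | _ h => exact op_mul g h q }
  refine ⟨act, fun _ _ => rfl, Set.rangeFactorization_surjective, ?_, ?_, ?_⟩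
  · intro g q
    induction g using QuotientGroup.induction_on with | _ g =>
    induction q using Quotient.inductionOn with | _ x => exact Subtype.ext (inv g x)
  · intro g q h
    induction g using QuotientGroup.induction_on with | _ g =>
    induction q using Quotient.inductionOn with | _ x =>
    exact (QuotientGroup.eq_one_iff g).mpr (free g x (Quotient.exact h))
  · intro p q h
    induction p using Quotient.inductionOn with | _ x =>
    induction q using Quotient.inductionOn with | _ y =>
    obtain ⟨g, hg⟩ := trans x y (congrArg Subtype.val h)
    exact ⟨QuotientGroup.mk g, Quotient.sound hg⟩

/-! ### Endomorphisms of invertible bimodules -/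

namespace Bimod

variable {k : Type w} {C B A : Type u} [CommRing k] [Ring C] [Algebra k C] [Ring B] [Algebra k B]
  [Ring A] [Algebra k A]

/-- The bilinear map `(x, y) ↦ f (x ⊗ y)` given by a linear map `f` on `E ⊗_B F`. -/
def pairing {N : Type*} [AddCommGroup N] [Module k N] (E : Bimod k C B) (F : Bimod k B A)
    (f : Tensor E F →ₗ[k] N) : E.carrier →ₗ[k] F.carrier →ₗ[k] N :=
  (TensorProduct.mk k E.carrier F.carrier).compr₂ (f ∘ₗ (balanced E F).mkQ)

@[simp] theorem pairing_apply {N : Type*} [AddCommGroup N] [Module k N] (E : Bimod k C B)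
    (F : Bimod k B A) (f : Tensor E F →ₗ[k] N) (x : E.carrier) (y : F.carrier) :
    pairing E F f x y = f (tmul E F x y) := rfl

theorem tmul_balanced (E : Bimod k C B) (F : Bimod k B A) (x : E.carrier) (b : B)
    (y : F.carrier) : tmul E F (E.right (op b) x) y = tmul E F x (F.left b y) := by
  rw [← sub_eq_zero]
  change (balanced E F).mkQ _ - (balanced E F).mkQ _ = 0
  rw [← map_sub]
  exact (Submodule.Quotient.mk_eq_zero _).mpr (Submodule.subset_span ⟨x, b, y, rfl⟩)

theorem exists_sum_tmul (E : Bimod k C B) (F : Bimod k B A) (z : Tensor E F) :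
    ∃ s : Finset (E.carrier × F.carrier), z = ∑ i ∈ s, tmul E F i.1 i.2 := by
  obtain ⟨t, rfl⟩ := Submodule.mkQ_surjective _ z
  obtain ⟨s, rfl⟩ := TensorProduct.exists_finset t
  exact ⟨s, map_sum _ _ _⟩

theorem tensor_induction (E : Bimod k C B) (F : Bimod k B A) {P : Tensor E F → Prop}
    (tmul : ∀ x y, P (tmul E F x y)) (add : ∀ z z', P z → P z' → P (z + z')) (z : Tensor E F) :
    P z := by
  obtain ⟨t, rfl⟩ := Submodule.mkQ_surjective _ z
  induction t with
  | zero => simpa [Bimod.tmul] using tmul 0 0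
  | tmul x y => exact tmul x y
  | add z z' h h' => rw [map_add]; exact add _ _ h h'

/-- The linear map on `E ⊗_B F` given by a balanced bilinear map. -/
def liftBalanced {N : Type*} [AddCommGroup N] [Module k N] (E : Bimod k C B) (F : Bimod k B A)
    (β : E.carrier →ₗ[k] F.carrier →ₗ[k] N)
    (hβ : ∀ x b y, β (E.right (op b) x) y = β x (F.left b y)) : Tensor E F →ₗ[k] N :=
  (balanced E F).liftQ (TensorProduct.lift β) (by
    rw [balanced, Submodule.span_le]
    rintro _ ⟨x, b, y, rfl⟩
    simp [hβ])

/-- The left action of `B` identifies `B` with the algebra of right `A`-linear endomorphisms. -/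
structure IsLeftFull (E : Bimod k B A) : Prop where
  injective : Function.Injective E.left
  exists_left : ∀ T : Module.End k E.carrier,
    (∀ a x, T (E.right (op a) x) = E.right (op a) (T x)) → ∃ b, E.left b = T

/-- A right `A`-linear map `T` on `E` induces a right `B`-linear map on `E ⊗_A F ≅ B`, which is the
multiplication by some `b`. Then `T - b` vanishes after applying `- ⊗_A F ⊗_B E`, which is the
identity functor up to isomorphism. -/
theorem IsEquivalence.isLeftFull {E : Bimod k B A} (h : E.IsEquivalence) : E.IsLeftFull := by
  obtain ⟨F, ⟨e, he⟩, ⟨f, hf⟩⟩ := h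
  obtain ⟨s, hs⟩ := exists_sum_tmul E F (e.symm 1)
  obtain ⟨t, ht⟩ := exists_sum_tmul F E (f.symm 1)
  have hs' : ∑ i ∈ s, e (tmul E F i.1 i.2) = 1 := by rw [← map_sum, ← hs, e.apply_symm_apply]
  have ht' : ∑ i ∈ t, f (tmul F E i.1 i.2) = 1 := by rw [← map_sum, ← ht, f.apply_symm_apply]
  have rightF (z : B) (x : E.carrier) (y : F.carrier) :
      e (tmul E F x (F.right (op z) y)) = e (tmul E F x y) * z := he.map_right z x y
  have leftE (z : B) (x : E.carrier) (y : F.carrier) :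
      e (tmul E F (E.left z x) y) = z * e (tmul E F x y) := he.map_left z x y
  have leftF (z : A) (y : F.carrier) (x : E.carrier) :
      f (tmul F E (F.left z y) x) = z * f (tmul F E y x) := hf.map_left z y x
  refine ⟨(injective_iff_map_eq_zero _).mpr fun b hb => ?_, fun T hT => ?_⟩
  · rw [← mul_one b, ← hs', Finset.mul_sum]
    refine Finset.sum_eq_zero fun i _ => ?_
    rw [← leftE, hb]
    simp [tmul]
  · let θ : Tensor E F →ₗ[k] B :=
      liftBalanced E F (pairing E F e.toLinearMap ∘ₗ T) fun x a y => by
        simp [hT, tmul_balanced]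
    have hθ (z : Tensor E F) : θ z = (∑ i ∈ s, e (tmul E F (T i.1) i.2)) * e z := by
      -- right linearity of `e` expands `z` as `1 · e(z)`, with `1 = ∑ e(xᵢ ⊗ yᵢ)`
      have hz : z = ∑ i ∈ s, tmul E F i.1 (F.right (op (e z)) i.2) := by
        apply e.injective
        simp only [map_sum, rightF, ← Finset.sum_mul, hs', one_mul]
      conv_lhs => rw [hz]
      simp only [map_sum, Finset.sum_mul]
      exact Finset.sum_congr rfl fun i _ => rightF _ _ _
    refine ⟨∑ i ∈ s, e (tmul E F (T i.1) i.2), ?_⟩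
    set b : B := ∑ i ∈ s, e (tmul E F (T i.1) i.2)
    ext x
    have hD (y : F.carrier) : tmul E F (E.left b x - T x) y = 0 := by
      apply e.injective
      have := hθ (tmul E F x y)
      rw [← leftE] at this
      have e1 : tmul E F (E.left b x - T x) y = tmul E F (E.left b x) y - tmul E F (T x) y := by
        simp [tmul, TensorProduct.sub_tmul]
      rw [e1, map_sub, ← this, map_zero]
      exact sub_self _
    have hβ (x' : E.carrier) (x : E.carrier) (a : A) (y : F.carrier) :
        E.right (op (f (tmul F E y x'))) (E.right (op a) x) =
          E.right (op (f (tmul F E (F.left a y) x'))) x := by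
      rw [leftF, op_mul, map_mul]
      rfl
    -- `u ⊗ y ↦ u · f(y ⊗ x')` is well defined on `E ⊗_A F`, where `(b · x - T x) ⊗ y` vanishes
    have hD' (y : F.carrier) (x' : E.carrier) :
        E.right (op (f (tmul F E y x'))) (E.left b x - T x) = 0 := by
      let β : E.carrier →ₗ[k] F.carrier →ₗ[k] E.carrier :=
        (E.right.toLinearMap ∘ₗ (opLinearEquiv k).toLinearMap ∘ₗ f.toLinearMap ∘ₗ
          (pairing F E LinearMap.id).flip x').flip
      have := congrArg (liftBalanced E F β (hβ x')) (hD y)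
      rwa [map_zero] at this
    rw [← sub_eq_zero]
    have e2 : E.right (op (1 : A)) (E.left b x - T x) = E.left b x - T x := by simp
    rw [← e2, ← ht', Finset.op_sum, map_sum, LinearMap.sum_apply]
    exact Finset.sum_eq_zero fun i _ => hD' i.1 i.2

end Bimod

/-! ### Non-degeneracy of Rieffel's inner product -/

namespace InnerBimod

variable {k : Type w} {C B A : Type u} [CommRing k] [StarRing k] [Ring C] [Algebra k C]
  [StarRing C] [Ring B] [Algebra k B] [StarRing B] [Ring A] [Algebra k A] [StarRing A]

theorem ext_inner (E : InnerBimod k B A) {x x' : E.carrier}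
    (h : ∀ y, E.inner y x = E.inner y x') : x = x' :=
  sub_eq_zero.mp <| E.inner_nondeg _ fun y => by rw [map_sub, h, sub_self]

theorem exists_sum_tmul (E : InnerBimod k C B) (F : InnerBimod k B A) (z : InnerTensor E F) :
    ∃ s : Finset (E.carrier × F.carrier), z = ∑ i ∈ s, tmul E F i.1 i.2 := by
  obtain ⟨t, rfl⟩ := Submodule.mkQ_surjective _ z
  obtain ⟨s, rfl⟩ := Bimod.exists_sum_tmul E.toBimod F.toBimod t
  exact ⟨s, map_sum _ _ _⟩

/-- An invertible inner product bimodule has a finite dual basis: `q(y, x) ∈ A` denoting the image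
of `y ⊗ x`, there is `v(y) ∈ E` with `q(y, x) = ⟨v(y), x⟩` because `1` is a sum of elements
`q(y, x)^*`; and `⟨x, z⟩` is a sum of elements `q(y, x)^* q(y', z)` because the inner product of `F`
takes values that add up to `1`. -/
theorem exists_dual_basis {E : InnerBimod k B A} {F : InnerBimod k A B}
    {e : InnerTensor E F ≃ₗ[k] B} (he : IsInnerTensorIso E F (regular k B) e)
    {f : InnerTensor F E ≃ₗ[k] A} (hf : IsInnerTensorIso F E (regular k A) f) :
    ∃ (ι : Type u) (s : Finset ι) (v w : ι → E.carrier),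
      ∀ z, z = ∑ i ∈ s, E.right (op (E.inner (w i) z)) (v i) := by
  obtain ⟨s, hs⟩ := exists_sum_tmul E F (e.symm 1)
  obtain ⟨t, ht⟩ := exists_sum_tmul F E (f.symm 1)
  have hs' : ∑ i ∈ s, e (tmul E F i.1 i.2) = 1 := by rw [← map_sum, ← hs, e.apply_symm_apply]
  have ht' : ∑ i ∈ t, f (tmul F E i.1 i.2) = 1 := by rw [← map_sum, ← ht, f.apply_symm_apply]
  have innerE (x y x' y') : star (e (tmul E F x y)) * e (tmul E F x' y') =
    F.inner y (F.left (E.inner x x') y') := he.map_inner x y x' y'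
  have innerF (y x y' x') : star (f (tmul F E y x)) * f (tmul F E y' x') =
    E.inner x (E.left (F.inner y y') x') := hf.map_inner y x y' x'
  let v (y : F.carrier) : E.carrier := ∑ j ∈ t, E.left (star (F.inner j.1 y)) j.2
  -- `q(y, x) = ∑ q(yⱼ, xⱼ)^* q(y, x)` since `∑ q(yⱼ, xⱼ) = 1`
  have hv (y : F.carrier) (x : E.carrier) : f (tmul F E y x) = E.inner (v y) x := by
    have e1 : star (∑ i ∈ t, f (tmul F E i.1 i.2)) * f (tmul F E y x) = f (tmul F E y x) := by
      rw [ht', star_one, one_mul]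
    rw [← e1, star_sum, Finset.sum_mul, E.inner_symm, map_sum, star_sum]
    refine Finset.sum_congr rfl fun j _ => ?_
    rw [innerF, ← E.inner_symm, E.inner_left]
  refine ⟨_, s ×ˢ s, fun i => v i.1.2, fun i => v (F.left (E.inner i.1.1 i.2.1) i.2.2),
    fun z => E.ext_inner fun x => ?_⟩
  -- the expansion of `1 = 1^* 1` where `1` is the image of a sum of elementary tensors
  have full : ∑ i ∈ s ×ˢ s, F.inner i.1.2 (F.left (E.inner i.1.1 i.2.1) i.2.2) = 1 := by
    simp only [← innerE]
    simp only [Finset.sum_product, ← Finset.mul_sum, hs', mul_one, ← star_sum, star_one]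
  have e2 : z = E.left 1 z := by simp
  conv_lhs => rw [e2, ← full]
  simp only [map_sum, LinearMap.sum_apply]
  refine Finset.sum_congr rfl fun i _ => ?_
  rw [E.inner_right, ← innerF, hv, hv, ← E.inner_symm]

/-- Expanding the first factor of a degenerate tensor in a dual basis shows that it vanishes. -/
theorem degeneracy_eq_bot {E : InnerBimod k B A} {F : InnerBimod k A B}
    {e : InnerTensor E F ≃ₗ[k] B} (he : IsInnerTensorIso E F (regular k B) e)
    {f : InnerTensor F E ≃ₗ[k] A} (hf : IsInnerTensorIso F E (regular k A) f) :
    degeneracy E F = ⊥ := by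
  obtain ⟨ι, s, v, w, hvw⟩ := exists_dual_basis he hf
  let Φ (x : E.carrier) : Bimod.Tensor E.toBimod F.toBimod →ₗ[k] F.carrier :=
    Bimod.liftBalanced E.toBimod F.toBimod (F.left.toLinearMap ∘ₗ E.inner x) fun x' b y => by
      simp [E.inner_right]
  rw [eq_bot_iff]
  intro z hz
  have h1 (x : E.carrier) : Φ x z = 0 := by
    refine F.inner_nondeg _ fun y => ?_
    have h0 : F.inner y ∘ₗ Φ x = rieffel E F x y :=
      Submodule.linearMap_qext _ (TensorProduct.ext' fun _ _ => rfl)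
    simp only [degeneracy, Submodule.mem_iInf, LinearMap.mem_ker] at hz
    rw [← LinearMap.comp_apply, h0, hz]
  have h2 : z = ∑ i ∈ s, Bimod.tmul E.toBimod F.toBimod (v i) (Φ (w i) z) := by
    clear hz h1
    induction z using Bimod.tensor_induction with
    | tmul x y =>
      have h3 (i : ι) : Φ (w i) (Bimod.tmul E.toBimod F.toBimod x y) =
        F.left (E.inner (w i) x) y := rfl
      simp only [h3, ← Bimod.tmul_balanced]
      conv_lhs => rw [hvw x]
      simp [Bimod.tmul, TensorProduct.sum_tmul]
    | add z z' h h' =>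
      conv_lhs => rw [h, h']
      simp [Bimod.tmul, TensorProduct.tmul_add, Finset.sum_add_distrib]
  rw [h2]
  simp [h1, Bimod.tmul]

theorem IsInnerTensorIso.isTensorIso {E : InnerBimod k C B} {F : InnerBimod k B A}
    {G : InnerBimod k C A} {e : InnerTensor E F ≃ₗ[k] G.carrier} (he : IsInnerTensorIso E F G e)
    (h : degeneracy E F = ⊥) :
    Bimod.IsTensorIso E.toBimod F.toBimod G.toBimod
      ((Submodule.quotEquivOfEqBot _ h).symm.trans e) :=
  ⟨he.map_left, he.map_right⟩

theorem IsStarEquivalence.toBimod {E : InnerBimod k B A} (h : E.IsStarEquivalence) :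
    E.toBimod.IsEquivalence := by
  obtain ⟨F, ⟨e, he⟩, ⟨f, hf⟩⟩ := h
  exact ⟨F.toBimod, ⟨_, he.isTensorIso (degeneracy_eq_bot he hf)⟩,
    ⟨_, hf.isTensorIso (degeneracy_eq_bot hf he)⟩⟩

end InnerBimod

/-! ### Cancellation of actions in Sweedler sums -/

section Cancellation

variable {k : Type w} {H : Type v} [CommRing k] [Ring H] [HopfAlgebra k H]

theorem sw_counit_left {X Y : Type*} [AddCommGroup X] [AddCommGroup Y] [Module k X] [Module k Y]
    {U : Type*} [AddCommGroup U] [Module k U] (β : U →ₗ[k] X →ₗ[k] Y) (u : U) (f : H →ₗ[k] X) :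
    sw β (LinearMap.toSpanSingleton k U u ∘ₗ counit) f = β u ∘ₗ f := by
  ext g
  rw [sw_apply _ _ _ (ℛ k g)]
  conv_rhs => rw [LinearMap.comp_apply, ← sum_counit_smul (ℛ k g)]
  simp

theorem sw_counit_right {X Y : Type*} [AddCommGroup X] [AddCommGroup Y] [Module k X] [Module k Y]
    {U : Type*} [AddCommGroup U] [Module k U] (β : X →ₗ[k] U →ₗ[k] Y) (u : U) (f : H →ₗ[k] X) :
    sw β f (LinearMap.toSpanSingleton k U u ∘ₗ counit) = β.flip u ∘ₗ f := by
  ext g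
  have h := congrArg (fun t => β.flip u (f (TensorProduct.rid k H t)))
    (sum_tmul_counit_eq (ℛ k g))
  simp only [map_sum, TensorProduct.rid_tmul, one_smul] at h
  rw [sw_apply _ _ _ (ℛ k g), LinearMap.comp_apply, ← h]
  simp

theorem ofConv_one_eq {D : Type*} [Ring D] [Algebra k D] :
    (1 : WithConv (H →ₗ[k] D)).ofConv = LinearMap.toSpanSingleton k D 1 ∘ₗ counit := by
  ext g
  simp [Algebra.algebraMap_eq_smul_one]

/-- A map `X` is determined by the sums `X(g₁) ∘ σ(g₂)`, since `X(g) = X(g₁) ∘ σ(g₂) ∘ σ(S(g₃))`. -/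
theorem comp_cancel {M N : Type*} [AddCommGroup M] [AddCommGroup N] [Module k M] [Module k N]
    (σ : H →ₐ[k] Module.End k M) {X Y : H →ₗ[k] M →ₗ[k] N}
    (h : sw (LinearMap.llcomp k M M N) X σ.toLinearMap =
      sw (LinearMap.llcomp k M M N) Y σ.toLinearMap) : X = Y := by
  have key (Z : H →ₗ[k] M →ₗ[k] N) : sw (LinearMap.llcomp k M M N)
      (sw (LinearMap.llcomp k M M N) Z σ.toLinearMap) (σ.toLinearMap ∘ₗ antipode k) = Z := by
    rw [sw_assoc _ _ (LinearMap.mul k (Module.End k M)) (LinearMap.llcomp k M M N)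
      (fun _ _ _ => rfl)]
    have : sw (LinearMap.mul k (Module.End k M)) σ.toLinearMap (σ.toLinearMap ∘ₗ antipode k) =
        (1 : WithConv (H →ₗ[k] Module.End k M)).ofConv := congrArg ofConv (antipode_conv σ).2
    rw [this, ofConv_one_eq, sw_counit_right]
    rfl
  rw [← key X, h, key]

end Cancellation

namespace HInnerBimod

variable {k : Type w} {H : Type v} {B A : Type u} [CommRing k] [StarRing k] [Ring H]
  [HopfAlgebra k H] [StarRing H] [StarModule k H] [Ring B] [Algebra k B] [StarRing B]
  [StarModule k B] [HopfStarAction k H B] [Ring A] [Algebra k A] [StarRing A] [StarModule k A]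
  [HopfStarAction k H A]

/-- The linear map `g ↦ ⟨g^* ▷ x, -⟩`. -/
noncomputable def innerStar (E : HInnerBimod k H B A) (x : E.carrier) :
    H →ₗ[k] E.carrier →ₗ[k] A where
  toFun g := E.inner (E.act (star g) x)
  map_add' g g' := by
    ext y
    simp [inner_add_left]
  map_smul' c g := by
    ext y
    simp [inner_smul_left, star_smul]

/-- A map `f` is determined by the sums `⟨S(g₁)^* ▷ y, f(g₂)⟩`, since
`⟨y, f(g)⟩ = ⟨(g₁ S(g₂))^* ▷ y, f(g₃)⟩ = ⟨S(g₂)^* ▷ (g₁^* ▷ y), f(g₃)⟩`. -/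
theorem inner_cancel (E : HInnerBimod k H B A) {f f' : H →ₗ[k] E.carrier}
    (h : ∀ y, sw (innerAct E y) LinearMap.id f = sw (innerAct E y) LinearMap.id f') : f = f' := by
  have key (f : H →ₗ[k] E.carrier) (y : E.carrier) :
      E.inner y ∘ₗ f = sw LinearMap.applyₗ LinearMap.id
        (sw (LinearMap.lflip.toLinearMap ∘ₗ ((LinearMap.mul k H).compr₂ (innerStar E y)).flip)
          (antipode k) f) := by
    rw [← sw_assoc (LinearMap.mul k H) (innerStar E y) _ _ (fun _ _ _ => rfl)]
    have : sw (LinearMap.mul k H) LinearMap.id (antipode k) =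
        (1 : WithConv (H →ₗ[k] H)).ofConv :=
      congrArg ofConv LinearMap.id_mul_antipode
    rw [this, ofConv_one_eq, sw_counit_left]
    simp [innerStar]
  have key2 (f : H →ₗ[k] E.carrier) (y : E.carrier) (g g' : H) :
      sw (LinearMap.lflip.toLinearMap ∘ₗ ((LinearMap.mul k H).compr₂ (innerStar E y)).flip)
          (antipode k) f g g' = sw (innerAct E (E.act (star g') y)) LinearMap.id f g := by
    rw [sw_apply _ _ _ (ℛ k g), sw_apply _ _ _ (ℛ k g), LinearMap.sum_apply]
    refine Finset.sum_congr rfl fun i _ => ?_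
    simp [innerStar, innerAct]
  ext g
  refine E.ext_inner fun y => ?_
  have : E.inner y ∘ₗ f = E.inner y ∘ₗ f' := by
    rw [key, key]
    congr 1
    ext g g'
    rw [key2, key2, h]
  exact congrArg (fun l => l g) this

end HInnerBimod

/-! ### Twisting an action on the right -/

section RightTwist

variable {k : Type w} {H : Type v} {B : Type u} [CommRing k] [Ring H] [HopfAlgebra k H]
  [Ring B] [Algebra k B] {M : Type*} [AddCommGroup M] [Module k M]

/-- The bilinear map `(x, b) ↦ x · b`. -/
noncomputable def rightMul (s : Bᵐᵒᵖ →ₐ[k] Module.End k M) : M →ₗ[k] B →ₗ[k] M :=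
  (s.toLinearMap ∘ₗ (opLinearEquiv k).toLinearMap).flip

/-- The bilinear map sending `(T, b)` to the map `x ↦ T(x) · b`. -/
noncomputable def thenRight (s : Bᵐᵒᵖ →ₐ[k] Module.End k M) :
    Module.End k M →ₗ[k] B →ₗ[k] Module.End k M :=
  (LinearMap.mul k (Module.End k M)).flip.compl₂ (rightMul s).flip

@[simp] theorem thenRight_apply (s : Bᵐᵒᵖ →ₐ[k] Module.End k M) (T : Module.End k M) (b : B) :
    thenRight s T b = s (op b) * T := rfl

/-- The map `g ↦ (x ↦ (g₁ ▷ x) · b(g₂))`. -/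
noncomputable def rightTwistLin (s : Bᵐᵒᵖ →ₐ[k] Module.End k M) (ρ : H →ₐ[k] Module.End k M)
    (b : WithConv (H →ₗ[k] B)) : H →ₗ[k] Module.End k M :=
  sw (thenRight s) ρ.toLinearMap b.ofConv

theorem rightTwistLin_apply (s : Bᵐᵒᵖ →ₐ[k] Module.End k M) (ρ : H →ₐ[k] Module.End k M)
    (b : WithConv (H →ₗ[k] B)) {g : H} {ι : Type*} (r : Repr k g ι) :
    rightTwistLin s ρ b g = ∑ i ∈ r.index, s (op (b (r.right i))) * ρ (r.left i) :=
  sw_apply _ _ _ r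

theorem sw_rightTwistLin (s : Bᵐᵒᵖ →ₐ[k] Module.End k M) (ρ : H →ₐ[k] Module.End k M)
    (b b' : WithConv (H →ₗ[k] B)) :
    sw (thenRight s) (rightTwistLin s ρ b) b'.ofConv = rightTwistLin s ρ (b * b') :=
  sw_assoc _ _ (LinearMap.mul k B) _ (fun T b b' => by simp [mul_assoc]) _ _ _

variable [HopfAction k H B] {s : Bᵐᵒᵖ →ₐ[k] Module.End k M} {ρ : H →ₐ[k] Module.End k M}

/-- Compatibility `g ▷ (x · b) = (g₁ ▷ x) · (g₂ ▷ b)` of actions on a right `B`-module. -/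
def RightCompat (s : Bᵐᵒᵖ →ₐ[k] Module.End k M) (ρ : H →ₐ[k] Module.End k M) : Prop :=
  ∀ (g : H) {ι : Type v} (r : Repr k g ι) (x : M) (b : B),
    ρ g (s (op b) x) = ∑ i ∈ r.index, s (op (hact k (r.right i) b)) (ρ (r.left i) x)

theorem RightCompat.rightTwistLin_orb (h : RightCompat s ρ) (b : B) (g : H) :
    rightTwistLin s ρ (orb k H b) g = ρ g * s (op b) := by
  ext y
  rw [rightTwistLin_apply s ρ _ (ℛ k g), LinearMap.sum_apply]
  exact (h g (ℛ k g) y b).symm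

theorem RightCompat.rightTwistLin_orb_mul (h : RightCompat s ρ) (b : WithConv (H →ₗ[k] B)) (c : B)
    (g : H) : rightTwistLin s ρ (orb k H c * b) g = rightTwistLin s ρ b g * s (op c) := by
  rw [← sw_rightTwistLin, sw_apply _ _ _ (ℛ k g), rightTwistLin_apply s ρ b (ℛ k g),
    Finset.sum_mul]
  exact Finset.sum_congr rfl fun i _ => by
    rw [thenRight_apply, h.rightTwistLin_orb, mul_assoc]

theorem RightCompat.rightTwistLin_mul (h : RightCompat s ρ) {b : WithConv (H →ₗ[k] B)}
    (hb : IsGL b) (g g' : H) :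
    rightTwistLin s ρ b (g * g') = rightTwistLin s ρ b g * rightTwistLin s ρ b g' := by
  rw [rightTwistLin_apply s ρ b ((ℛ k g).mul (ℛ k g')), rightTwistLin_apply s ρ b (ℛ k g'),
    Finset.mul_sum]
  simp only [← mul_assoc, ← h.rightTwistLin_orb_mul, hb.comm']
  simp only [rightTwistLin_apply s ρ _ (ℛ k g), ← hb.map_mul', Finset.sum_mul]
  simp only [Coalgebra.Repr.mul_index, Coalgebra.Repr.mul_left, Coalgebra.Repr.mul_right,
    Finset.sum_product_right, map_mul, mul_assoc]

/-- The action `(g, x) ↦ (g₁ ▷ x) · b(g₂)` for `b` in `GL(H, B)`. -/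
noncomputable def rightTwistAct (h : RightCompat s ρ) (b : GLH k H B) : H →ₐ[k] Module.End k M :=
  AlgHom.ofLinearMap (rightTwistLin s ρ b.val)
    (by simp [rightTwistLin, sw, Algebra.TensorProduct.one_def, b.isGL.map_one])
    (h.rightTwistLin_mul b.isGL)

theorem rightTwistAct_apply (h : RightCompat s ρ) (b : GLH k H B) {g : H} {ι : Type*}
    (r : Repr k g ι) (x : M) : rightTwistAct h b g x =
      ∑ i ∈ r.index, s (op (b.val (r.right i))) (ρ (r.left i) x) := by
  change rightTwistLin s ρ b.val g x = _
  rw [rightTwistLin_apply s ρ _ r, LinearMap.sum_apply]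
  rfl

theorem rightTwist_rightCompat (h : RightCompat s ρ) (b : GLH k H B) :
    RightCompat s (rightTwistAct h b) := by
  intro g ι r x c
  have e := h.rightTwistLin_orb_mul b.val c g
  rw [b.isGL.comm', ← sw_rightTwistLin, sw_apply _ _ _ r] at e
  have e' := congrArg (fun T => T x) e
  simp only [LinearMap.sum_apply] at e'
  exact e'.symm

theorem rightTwist_leftCompat {A : Type*} [Ring A] [Algebra k A] [HopfAction k H A]
    {l : A →ₐ[k] Module.End k M} (hl : LeftCompat l ρ)
    (hls : ∀ (a : A) (x : M) (b : B), l a (s (op b) x) = s (op b) (l a x))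
    (h : RightCompat s ρ) (b : GLH k H B) : LeftCompat l (rightTwistAct h b) := by
  intro g ι r c x
  have h1 : sw l.toLinearMap (orb k H c).ofConv (ρ.toLinearMap.flip x) =
      ρ.toLinearMap.flip (l c x) := by
    ext g
    rw [sw_apply _ _ _ (ℛ k g)]
    exact (hl g (ℛ k g) c x).symm
  have h2 := sw_assoc l.toLinearMap (rightMul s) (rightMul s) l.toLinearMap
    (fun c y b => (hls c y b).symm) (orb k H c).ofConv (ρ.toLinearMap.flip x) b.val.ofConv
  have h3 (g : H) (y : M) : sw (rightMul s) (ρ.toLinearMap.flip y) b.val.ofConv g =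
      rightTwistAct h b g y := by
    rw [sw_apply _ _ _ (ℛ k g), rightTwistAct_apply h b (ℛ k g)]
    rfl
  rw [h1] at h2
  have h4 := congrArg (fun f => f g) h2
  rw [h3, sw_apply _ _ _ r] at h4
  simp only [h3] at h4
  exact h4

theorem flip_rightTwistAct (h : RightCompat s ρ) (b : GLH k H B) (x : M) :
    (rightTwistAct h b).toLinearMap.flip x =
      sw (rightMul s) (ρ.toLinearMap.flip x) b.val.ofConv := by
  ext g
  rw [sw_apply _ _ _ (ℛ k g)]
  exact rightTwistAct_apply h b (ℛ k g) x

theorem flip_twistAct {l : B →ₐ[k] Module.End k M} (h : LeftCompat l ρ) (a : GLH k H B) (x : M) :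
    (twistAct l ρ h a.val a.isGL).toLinearMap.flip x =
      sw l.toLinearMap a.val.ofConv (ρ.toLinearMap.flip x) := by
  ext g
  rw [sw_apply _ _ _ (ℛ k g)]
  exact twistAct_apply h a.isGL (ℛ k g) x

variable {N : Type*} [AddCommGroup N] [Module k N] {l : B →ₐ[k] Module.End k N}
  {τ : H →ₐ[k] Module.End k N}

/-- `a(g₁) · p(g₂ ▷ x, g₃ ▷ y) · a⁻¹(g₄) = g ▷ p(x, y)`, as `a⁻¹` commutes with orbit maps. -/
theorem sw_twist_rightTwist (hl : LeftCompat l τ) (hs : RightCompat s ρ) (a : GLH k H B)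
    (p : N →ₗ[k] M →ₗ[k] B) (left : ∀ b x y, p (l b x) y = b * p x y)
    (right : ∀ b x y, p x (s (op b) y) = p x y * b)
    (act : ∀ x y g, ∑ i ∈ (ℛ k g).index, p (τ ((ℛ k g).left i) x) (ρ ((ℛ k g).right i) y) =
      hact k g (p x y))
    (x : N) (y : M) {g : H} {ι : Type*} (r : Repr k g ι) :
    ∑ i ∈ r.index, p (twistAct l τ hl a.val a.isGL (r.left i) x)
      (rightTwistAct hs a⁻¹ (r.right i) y) = hact k g (p x y) := by
  have e1 : a.val * (a⁻¹).val = 1 := congrArg GLH.val (mul_inv_cancel a)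
  have e2 : sw p (τ.toLinearMap.flip x) (ρ.toLinearMap.flip y) =
      (orb k H (p x y)).ofConv := by
    ext g
    rw [sw_apply _ _ _ (ℛ k g)]
    exact act x y g
  have e3 : sw p ((twistAct l τ hl a.val a.isGL).toLinearMap.flip x)
      ((rightTwistAct hs a⁻¹).toLinearMap.flip y) = (orb k H (p x y)).ofConv := by
    rw [flip_twistAct, flip_rightTwistAct, sw_assoc _ _ p (LinearMap.mul k B) left,
      ← sw_assoc p (LinearMap.mul k B) (rightMul s) p (fun x y b => (right b x y).symm), e2]
    change (a.val * (orb k H (p x y) * (a⁻¹).val)).ofConv = _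
    rw [(a⁻¹).isGL.comm', ← mul_assoc, e1, one_mul]
  have e4 := congrArg (fun f => f g) e3
  rwa [sw_apply _ _ _ r] at e4

/-- `q((g₁ ▷ y) · a⁻¹(g₂), a(g₃) · (g₄ ▷ x)) = q(g₁ ▷ y, g₂ ▷ x)` for balanced `q`. -/
theorem sw_rightTwist_twist {P : Type*} [AddCommGroup P] [Module k P] (hl : LeftCompat l τ)
    (hs : RightCompat s ρ) (a : GLH k H B) (q : M →ₗ[k] N →ₗ[k] P)
    (balanced : ∀ y b x, q (s (op b) y) x = q y (l b x)) (x : N) (y : M) {g : H} {ι : Type*}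
    (r : Repr k g ι) :
    ∑ i ∈ r.index, q (rightTwistAct hs a⁻¹ (r.left i) y)
      (twistAct l τ hl a.val a.isGL (r.right i) x) =
    ∑ i ∈ r.index, q (ρ (r.left i) y) (τ (r.right i) x) := by
  have e1 : (a⁻¹).val * a.val = 1 := congrArg GLH.val (inv_mul_cancel a)
  have e2 : sw q ((rightTwistAct hs a⁻¹).toLinearMap.flip y)
      ((twistAct l τ hl a.val a.isGL).toLinearMap.flip x) =
      sw q (ρ.toLinearMap.flip y) (τ.toLinearMap.flip x) := by
    rw [flip_twistAct, flip_rightTwistAct, sw_assoc _ _ l.toLinearMap q balanced,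
      ← sw_assoc (LinearMap.mul k B) l.toLinearMap _ _ (fun b b' x => by simp)]
    have e2 : sw (LinearMap.mul k B) (a⁻¹).val.ofConv a.val.ofConv =
        (1 : WithConv (H →ₗ[k] B)).ofConv := congrArg ofConv e1
    rw [e2, ofConv_one_eq, sw_counit_left]
    simp only [AlgHom.toLinearMap_apply, map_one]
    rfl
  have e3 := congrArg (fun f => f g) e2
  rwa [sw_apply _ _ _ r, sw_apply _ _ _ r] at e3

end RightTwist

/-! ### Inverses of twisted bimodules -/

namespace HBimod

variable {k : Type w} {H : Type v} {B A : Type u} [CommRing k] [Ring H] [HopfAlgebra k H]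
  [Ring B] [Algebra k B] [HopfAction k H B] [Ring A] [Algebra k A] [HopfAction k H A]

/-- The bimodule `F` with the action `(g, y) ↦ (g₁ ▷ y) · b(g₂)` for `b` in `GL(H, B)`. -/
noncomputable def rightTwist (b : GLH k H B) (F : HBimod k H A B) : HBimod k H A B where
  toBimod := F.toBimod
  act := rightTwistAct (s := F.right) F.act_right b
  act_left := rightTwist_leftCompat F.act_left F.left_right F.act_right b
  act_right := rightTwist_rightCompat F.act_right b

/-- Twisting the inverse of `E` on the right by `a⁻¹` gives an inverse of the twist of `E` by
`a`. -/
theorem IsEquivalence.twist {E : HBimod k H B A} (h : E.IsEquivalence) (a : GLH k H B) :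
    (HBimod.twist a E).IsEquivalence := by
  obtain ⟨F, ⟨e, he⟩, ⟨f, hf⟩⟩ := h
  refine ⟨rightTwist a⁻¹ F, ⟨e, he.toIsTensorIso, fun g ι r x y => ?_⟩,
    ⟨f, hf.toIsTensorIso, fun g ι r y x => ?_⟩⟩
  · exact (map_sum e _ _).trans <| sw_twist_rightTwist E.act_left F.act_right a
      (Bimod.pairing E.toBimod F.toBimod e.toLinearMap) he.map_left he.map_right
      (fun x y g => (map_sum e _ _).symm.trans (he.map_act g (ℛ k g) x y)) x y r
  · exact (map_sum f _ _).trans <| (sw_rightTwist_twist E.act_left F.act_right a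
      (Bimod.pairing F.toBimod E.toBimod f.toLinearMap)
      (fun y b x => congrArg f (Bimod.tmul_balanced _ _ y b x)) x y r).trans <|
      (map_sum f _ _).symm.trans (hf.map_act g r y x)

end HBimod

namespace HInnerBimod

variable {k : Type w} {H : Type v} {B A : Type u} [CommRing k] [StarRing k] [Ring H]
  [HopfAlgebra k H] [StarRing H] [StarModule k H] [Ring B] [Algebra k B] [StarRing B]
  [StarModule k B] [HopfStarAction k H B] [Ring A] [Algebra k A] [StarRing A] [StarModule k A]
  [HopfStarAction k H A]

theorem sw_innerAct (E : HInnerBimod k H B A) (x y : E.carrier) :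
    sw (innerAct E x) LinearMap.id (E.act.toLinearMap.flip y) =
      (orb k H (E.inner x y)).ofConv := by
  ext g
  rw [sw_apply _ _ _ (ℛ k g)]
  exact (E.act_inner g (ℛ k g) x y).symm

theorem sw_innerAct_rightMul (E : HInnerBimod k H B A) (y : E.carrier) (f : H →ₗ[k] E.carrier)
    (a : H →ₗ[k] A) : sw (innerAct E y) LinearMap.id (sw (rightMul E.right) f a) =
      sw (LinearMap.mul k A) (sw (innerAct E y) LinearMap.id f) a :=
  (sw_assoc (innerAct E y) (LinearMap.mul k A) (rightMul E.right) (innerAct E y)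
    (fun g z a => (E.inner_right (E.act (star (antipode k g)) y) z a).symm) _ _ _).symm

theorem act_right (E : HInnerBimod k H B A) : RightCompat E.right E.act := by
  intro g ι r x a
  have h : E.act.toLinearMap.flip (E.right (op a) x) =
      sw (rightMul E.right) (E.act.toLinearMap.flip x) (orb k H a).ofConv := by
    refine E.inner_cancel fun y => ?_
    rw [sw_innerAct_rightMul, sw_innerAct, sw_innerAct, E.inner_right, orb_mul]
    rfl
  have := congrArg (fun f => f g) h
  rwa [sw_apply _ _ _ r] at this

/-- The `H`-covariant bimodule underlying an `H`-covariant inner product bimodule. -/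
abbrev toHBimod (E : HInnerBimod k H B A) : HBimod k H B A where
  toBimod := E.toBimod
  act := E.act
  act_left := E.act_left
  act_right := E.act_right

theorem inner_right_left (E : InnerBimod k B A) (a : A) (x y : E.carrier) :
    E.inner (E.right (op a) x) y = star a * E.inner x y := by
  rw [E.inner_symm, E.inner_right, star_mul, ← E.inner_symm]

variable [HopfStarAlgebra k H]

theorem dagger_mul_self (a : UH k H B) : dagger a.1.val * a.1.val = 1 := by
  have h1 := (isUnitaryH_iff a.1.val).mp a.2
  have h2 : (a.1⁻¹).val * a.1.val = 1 := congrArg GLH.val (inv_mul_cancel a.1)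
  rwa [left_inv_eq_right_inv h2 h1] at h2

/-- `b(S(g₁)^*)^* (g₂ ▷ ⟨x, y⟩) b(g₃) = g ▷ ⟨x, y⟩`, as `b` commutes with orbit maps. -/
theorem rightTwist_inner (b : UH k H B) (F : HInnerBimod k H A B) (g : H) {ι : Type v}
    (r : Repr k g ι) (x y : F.carrier) :
    hact k g (F.inner x y) = ∑ i ∈ r.index,
      F.inner (rightTwistAct F.act_right b.1 (star (antipode k (r.left i))) x)
        (rightTwistAct F.act_right b.1 (r.right i) y) := by
  let τ := rightTwistAct F.act_right b.1
  let κ : B →ₗ[k] (F.carrier →ₗ[k] B) →ₗ[k] (F.carrier →ₗ[k] B) :=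
    LinearMap.llcomp k F.carrier B B ∘ₗ LinearMap.mul k B
  let γ : (F.carrier →ₗ[k] B) →ₗ[k] F.carrier →ₗ[k] B := LinearMap.id
  have e1 (g : H) : sw κ (dagger b.1.val).ofConv (innerAct F x) g =
      F.inner (τ (star (antipode k g)) x) := by
    ext z
    rw [rightTwistAct_apply F.act_right b.1 (starAntipodeRepr (ℛ k g)), sw_apply _ _ _ (ℛ k g),
      LinearMap.sum_apply, inner_sum_left]
    exact Finset.sum_congr rfl fun i _ => (inner_right_left _ _ _ _).symm
  have e2 (f : H →ₗ[k] F.carrier) : sw γ (innerAct F x) f = sw (innerAct F x) LinearMap.id f := by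
    ext g
    rw [sw_apply _ _ _ (ℛ k g), sw_apply _ _ _ (ℛ k g)]
    rfl
  have e3 : sw γ (sw κ (dagger b.1.val).ofConv (innerAct F x)) (τ.toLinearMap.flip y) =
      (orb k H (F.inner x y)).ofConv := by
    rw [flip_rightTwistAct, sw_assoc κ γ γ (LinearMap.mul k B) (fun _ _ _ => rfl), e2,
      sw_innerAct_rightMul, sw_innerAct]
    change (dagger b.1.val * (orb k H (F.inner x y) * b.1.val)).ofConv = _
    rw [b.1.isGL.comm', ← mul_assoc, dagger_mul_self, one_mul]
  have e4 := congrArg (fun f => f g) e3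
  simp only [sw_apply _ _ _ r, e1] at e4
  exact e4.symm

/-- The bimodule `F` with the same inner product and the action `(g, y) ↦ (g₁ ▷ y) · b(g₂)` for `b`
in `U(H, B)`. -/
noncomputable def rightTwist (b : UH k H B) (F : HInnerBimod k H A B) : HInnerBimod k H A B where
  toInnerBimod := F.toInnerBimod
  act := rightTwistAct F.act_right b.1
  act_inner := rightTwist_inner b F
  act_left := rightTwist_leftCompat F.act_left F.left_right F.act_right b.1

theorem IsHInnerTensorIso.twist_rightTwist {E : HInnerBimod k H B A} {F : HInnerBimod k H A B}
    {e : InnerBimod.InnerTensor E.toInnerBimod F.toInnerBimod ≃ₗ[k] B}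
    (he : IsHInnerTensorIso E F (regular k H B) e) (a : UH k H B) :
    IsHInnerTensorIso (twist a E) (rightTwist a⁻¹ F) (regular k H B) e := by
  refine ⟨he.toIsInnerTensorIso, fun g ι r x y => ?_⟩
  exact (map_sum e _ _).trans <| sw_twist_rightTwist E.act_left F.act_right a.1
    (Bimod.pairing E.toBimod F.toBimod (e.toLinearMap ∘ₗ Submodule.mkQ _))
    he.map_left he.map_right
    (fun x y g => (map_sum e _ _).symm.trans (he.map_act g (ℛ k g) x y)) x y r

theorem IsHInnerTensorIso.rightTwist_twist {E : HInnerBimod k H B A} {F : HInnerBimod k H A B}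
    {G : HInnerBimod k H A A}
    {f : InnerBimod.InnerTensor F.toInnerBimod E.toInnerBimod ≃ₗ[k] G.carrier}
    (hf : IsHInnerTensorIso F E G f) (a : UH k H B) :
    IsHInnerTensorIso (rightTwist a⁻¹ F) (twist a E) G f := by
  refine ⟨hf.toIsInnerTensorIso, fun g ι r y x => ?_⟩
  exact (map_sum f _ _).trans <| (sw_rightTwist_twist E.act_left F.act_right a.1
    (Bimod.pairing F.toBimod E.toBimod (f.toLinearMap ∘ₗ Submodule.mkQ _))
    (fun y b x => congrArg (fun z => f (Submodule.mkQ _ z)) (Bimod.tmul_balanced _ _ y b x))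
    x y r).trans <| (map_sum f _ _).symm.trans (hf.map_act g r y x)

theorem IsStarEquivalence.twist {E : HInnerBimod k H B A} (h : E.IsStarEquivalence)
    (a : UH k H B) : (HInnerBimod.twist a E).IsStarEquivalence := by
  obtain ⟨F, ⟨e, he⟩, ⟨f, hf⟩⟩ := h
  exact ⟨rightTwist a⁻¹ F, ⟨e, he.twist_rightTwist a⟩, ⟨f, hf.rightTwist_twist a⟩⟩

end HInnerBimod

theorem HInnerBimod.IsStrongEquivalence.twist {R : Type w} {H : Type v} {B A : Type u}
    [CommRing R] [LinearOrder R] [IsStrictOrderedRing R] [Ring H] [HopfAlgebra (Cx R) H]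
    [StarRing H] [StarModule (Cx R) H] [HopfStarAlgebra (Cx R) H] [Ring B] [Algebra (Cx R) B]
    [StarRing B] [Ring A] [Algebra (Cx R) A] [StarRing A] [StarModule (Cx R) B]
    [HopfStarAction (Cx R) H B] [StarModule (Cx R) A] [HopfStarAction (Cx R) H A]
    {E : HInnerBimod (Cx R) H B A} (h : E.IsStrongEquivalence) (a : UH (Cx R) H B) :
    (HInnerBimod.twist a E).IsStrongEquivalence := by
  obtain ⟨hE, F, hF, ⟨e, he⟩, ⟨f, hf⟩⟩ := h
  exact ⟨hE, rightTwist a⁻¹ F, hF, ⟨e, he.twist_rightTwist a⟩, ⟨f, hf.rightTwist_twist a⟩⟩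

/-! ### Twists of a fixed action -/

section Twists

variable {k : Type w} {H : Type v} {B : Type u} [CommRing k] [Ring H] [HopfAlgebra k H]
  [Ring B] [Algebra k B] [HopfAction k H B] {M : Type*} [AddCommGroup M] [Module k M]
  {l : B →ₐ[k] Module.End k M} {ρ : H →ₐ[k] Module.End k M}

theorem twistLin_injective (hl : Function.Injective l) :
    Function.Injective (twistLin (H := H) l ρ) := by
  intro a b h
  have e := congrArg (· * toConv (ρ.toLinearMap ∘ₗ antipode k)) h
  simp only [twistLin, mul_assoc, (antipode_conv ρ).2, mul_one] at e
  ext g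
  exact hl (congrArg (fun f => f g) e)

theorem twistLin_one : twistLin l ρ 1 = toConv ρ.toLinearMap := by
  rw [twistLin, comp_convOne, one_mul]

theorem twistLin_constConv_mul (a : WithConv (H →ₗ[k] B)) (b : B) (g : H) :
    twistLin l ρ (constConv k H b * a) g = l b * twistLin l ρ a g := by
  have e : toConv (l.toLinearMap ∘ₗ (constConv k H b).ofConv) = constConv k H (l b) := by
    ext g
    simp [constConv]
  rw [twistLin, comp_conv, mul_assoc, e, constConv_mul]
  rfl

theorem twistAct_one (h : LeftCompat l ρ) :
    twistAct l ρ h (1 : GLH k H B).val (1 : GLH k H B).isGL = ρ := by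
  ext1 g
  change twistLin l ρ 1 g = ρ g
  rw [twistLin_one]
  rfl

theorem twistAct_mul (h : LeftCompat l ρ) (a b : GLH k H B) :
    twistAct l ρ h (a * b).val (a * b).isGL =
      twistAct l (twistAct l ρ h b.val b.isGL) (twist_leftCompat h b.isGL) a.val a.isGL := by
  ext1 g
  change twistLin l ρ (a.val * b.val) g =
    (toConv (l.toLinearMap ∘ₗ a.val.ofConv) * twistLin l ρ b.val) g
  rw [twistLin, comp_conv, mul_assoc]
  rfl

/-- The action twisted by `ĉ` is `(g, x) ↦ c · (g ▷ (c⁻¹ · x))`. -/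
theorem twistAct_hat (h : LeftCompat l ρ) (c : (Subring.center B)ˣ) (g : H) (x : M) :
    twistAct l ρ h (hatHom k H B c).val (hatHom k H B c).isGL g x =
      l (c : B) (ρ g (l ((c⁻¹ : (Subring.center B)ˣ) : B) x)) := by
  change twistLin l ρ (hat k H c).val g x = _
  rw [hat_eq, ← constConv_comm (c : Subring.center B).2, twistLin_constConv_mul,
    ← one_mul (orb k H _), twistLin_mul_orb h, twistLin_one]
  rfl

/-- If `x ↦ c · x` intertwines the action twisted by `a` with the given one, then
`c a(g) = g ▷ c`. -/
theorem constConv_mul_eq_orb (hl : Function.Injective l) (h : LeftCompat l ρ) (a : GLH k H B)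
    (c : B) (hc : ∀ g x, l c (twistAct l ρ h a.val a.isGL g x) = ρ g (l c x)) :
    constConv k H c * a.val = orb k H c := by
  apply twistLin_injective (ρ := ρ) hl
  ext g x
  rw [twistLin_constConv_mul, ← one_mul (orb k H c), twistLin_mul_orb h, twistLin_one]
  exact hc g x

/-- A central unit `c` with `c a(g) = g ▷ c` exhibits `a` as the element belonging to `c⁻¹`. -/
theorem hatHom_inv_eq (a : GLH k H B) (c : (Subring.center B)ˣ)
    (h : constConv k H (c : B) * a.val = orb k H (c : B)) : hatHom k H B c⁻¹ = a := by
  apply GLH.ext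
  change (hat k H c⁻¹).val = a.val
  have e : ((c⁻¹ : (Subring.center B)ˣ) : B) * (c : B) = 1 := congrArg Subtype.val c.inv_mul
  rw [hat_eq, inv_inv, ← h, constConv_comm (c : Subring.center B).2]
  ext g
  rw [mul_constConv, mul_constConv, mul_assoc]
  rw [Subring.mem_center_iff.mp (c⁻¹ : (Subring.center B)ˣ).1.2 (c : B), e, mul_one]

end Twists

/-! ### Comparison of two actions on one bimodule -/

section Comparison

variable {k : Type w} {H : Type v} {B A : Type u} [CommRing k] [Ring H] [HopfAlgebra k H]
  [Ring B] [Algebra k B] [HopfAction k H B] [Ring A] [Algebra k A] [HopfAction k H A]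
  {M : Type*} [AddCommGroup M] [Module k M]

/-- The tensor product of two actions, `g ▷ (x ⊗ a) = (g₁ ▷ x) ⊗ (g₂ ▷ a)`. -/
noncomputable def tensorAct {N : Type*} [AddCommGroup N] [Module k N]
    (ρ : H →ₐ[k] Module.End k M) (τ : H →ₐ[k] Module.End k N) :
    H →ₐ[k] Module.End k (M ⊗[k] N) :=
  (Module.endTensorEndAlgHom (R := k) (S := k) (A := k) (M := M) (N := N)).comp
    ((Algebra.TensorProduct.map ρ τ).comp (Bialgebra.comulAlgHom k H))

theorem tensorAct_tmul {N : Type*} [AddCommGroup N] [Module k N]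
    (ρ : H →ₐ[k] Module.End k M) (τ : H →ₐ[k] Module.End k N) (g : H) (x : M) (y : N) :
    tensorAct ρ τ g (x ⊗ₜ[k] y) =
      sw (TensorProduct.mk k M N) (ρ.toLinearMap.flip x) (τ.toLinearMap.flip y) g := by
  rw [sw_apply _ _ _ (ℛ k g)]
  simp only [tensorAct, AlgHom.comp_apply, Bialgebra.comulAlgHom_apply]
  conv_lhs => rw [← (ℛ k g).eq]
  simp [LinearMap.sum_apply, Module.endTensorEndAlgHom_apply]

/-- The map `g ↦ (g₁ ▷' -) ∘ (S(g₂) ▷ -)` comparing two actions. -/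
noncomputable def quotLin (ρ ρ' : H →ₐ[k] Module.End k M) : WithConv (H →ₗ[k] Module.End k M) :=
  toConv ρ'.toLinearMap * toConv (ρ.toLinearMap ∘ₗ antipode k)

theorem quotLin_mul (ρ ρ' : H →ₐ[k] Module.End k M) :
    quotLin ρ ρ' * toConv ρ.toLinearMap = toConv ρ'.toLinearMap := by
  rw [quotLin, mul_assoc, (antipode_conv ρ).1, mul_one]

/-- The maps `(x, a) ↦ Λ(g)(x · a)` and `(x, a) ↦ Λ(g)(x) · a`, where `Λ(g)` compares the two
actions, agree because both become `(x, a) ↦ g ▷' (x · a)` after convolution with the action of `H`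
on the tensor product, which can be cancelled. -/
theorem quotLin_right {s : Aᵐᵒᵖ →ₐ[k] Module.End k M} {ρ ρ' : H →ₐ[k] Module.End k M}
    (h : RightCompat s ρ) (h' : RightCompat s ρ') (g : H) (a : A) (x : M) :
    quotLin ρ ρ' g (s (op a) x) = s (op a) (quotLin ρ ρ' g x) := by
  let Λ : H →ₗ[k] Module.End k M := (quotLin ρ ρ').ofConv
  let m : M ⊗[k] A →ₗ[k] M := TensorProduct.lift (rightMul s)
  let σ : H →ₐ[k] Module.End k (M ⊗[k] A) := tensorAct ρ HopfAction.act
  let X : H →ₗ[k] M ⊗[k] A →ₗ[k] M := LinearMap.lcomp k M m ∘ₗ Λ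
  let Y : H →ₗ[k] M ⊗[k] A →ₗ[k] M :=
    LinearMap.llcomp k (M ⊗[k] A) (M ⊗[k] A) M m ∘ₗ LinearMap.rTensorHom A ∘ₗ Λ
  have hΛ (x : M) : sw LinearMap.id Λ (ρ.toLinearMap.flip x) = ρ'.toLinearMap.flip x := by
    ext g
    have e := congrArg (fun f => f g x) (quotLin_mul ρ ρ')
    simp only [(ℛ k g).convMul_apply, LinearMap.sum_apply] at e
    rw [sw_apply _ _ _ (ℛ k g)]
    exact e
  have hρ (ρ : H →ₐ[k] Module.End k M) (h : RightCompat s ρ) (a : A) (x : M) :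
      sw (rightMul s) (ρ.toLinearMap.flip x) (orb k H a).ofConv =
        ρ.toLinearMap.flip (s (op a) x) := by
    ext g
    rw [sw_apply _ _ _ (ℛ k g)]
    exact (h g (ℛ k g) x a).symm
  have hσ (g : H) (x : M) (a : A) : m (σ g (x ⊗ₜ a)) = ρ g (s (op a) x) := by
    rw [tensorAct_tmul, sw_apply _ _ _ (ℛ k g), map_sum]
    exact (h g (ℛ k g) x a).symm
  have hX (g : H) (x : M) (a : A) : sw (LinearMap.llcomp k (M ⊗[k] A) (M ⊗[k] A) M) X
      σ.toLinearMap g (x ⊗ₜ a) = ρ' g (s (op a) x) := by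
    have e := congrArg (fun f => f g) (hΛ (s (op a) x))
    rw [sw_apply _ _ _ (ℛ k g)] at e
    rw [sw_apply _ _ _ (ℛ k g), LinearMap.sum_apply]
    refine Eq.trans (Finset.sum_congr rfl fun i _ => ?_) e
    exact congrArg (Λ _) (hσ _ x a)
  have hY (g : H) (x : M) (a : A) : sw (LinearMap.llcomp k (M ⊗[k] A) (M ⊗[k] A) M) Y
      σ.toLinearMap g (x ⊗ₜ a) = ρ' g (s (op a) x) := by
    have e1 := sw_assoc (LinearMap.id : Module.End k M →ₗ[k] Module.End k M) (rightMul s)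
      (TensorProduct.mk k M A)
      (LinearMap.llcomp k (M ⊗[k] A) (M ⊗[k] A) M m ∘ₗ LinearMap.rTensorHom A)
      (fun T x a => by simp [m]) Λ (ρ.toLinearMap.flip x) (orb k H a).ofConv
    rw [hΛ, hρ ρ' h'] at e1
    have e2 := congrArg (fun f => f g) e1
    rw [sw_apply _ _ _ (ℛ k g)] at e2
    rw [sw_apply _ _ _ (ℛ k g), LinearMap.sum_apply]
    refine Eq.trans (Finset.sum_congr rfl fun i _ => ?_) e2.symm
    exact congrArg (fun z => m (LinearMap.rTensor A (Λ _) z)) (tensorAct_tmul ρ _ _ x a)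
  have hXY : X = Y := comp_cancel σ (by
    ext g x a
    exact (hX g x a).trans (hY g x a).symm)
  exact congrArg (fun f => f g (x ⊗ₜ[k] a)) hXY

/-- If the comparison of two actions takes its values in the left multiplications, then it defines
an element of `GL(H, B)`. -/
theorem isGL_of_quotLin {l : B →ₐ[k] Module.End k M} {ρ ρ' : H →ₐ[k] Module.End k M}
    (hl : Function.Injective l) (h : LeftCompat l ρ) (h' : LeftCompat l ρ')
    {a : WithConv (H →ₗ[k] B)} (ha : ∀ g, l (a g) = quotLin ρ ρ' g) : IsGL a := by
  let L (f : WithConv (H →ₗ[k] B)) : WithConv (H →ₗ[k] Module.End k M) :=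
    toConv (l.toLinearMap ∘ₗ f.ofConv)
  have hL : L a = quotLin ρ ρ' := by
    ext g : 2
    exact ha g
  have L_mul (f f' : WithConv (H →ₗ[k] B)) : L (f * f') = L f * L f' := comp_conv l f f'
  have L_inj (f f' : WithConv (H →ₗ[k] B)) (e : L f = L f') : f = f' := by
    ext g
    exact hl (congrArg (fun f => f g) e)
  have orb_left (ρ : H →ₐ[k] Module.End k M) (h : LeftCompat l ρ) (b : B) :
      L (orb k H b) * toConv ρ.toLinearMap = toConv ρ.toLinearMap * constConv k H (l b) := by
    ext g : 2
    rw [mul_constConv]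
    exact h.conv b g
  have comm (b : B) : orb k H b * a = a * orb k H b := by
    -- both sides become `ρ'(g) ∘ b` after convolution with the invertible `ρ`
    apply L_inj
    have e : L (orb k H b) * L a * toConv ρ.toLinearMap =
        L a * L (orb k H b) * toConv ρ.toLinearMap := by
      rw [mul_assoc, hL, quotLin_mul, orb_left ρ' h', mul_assoc, orb_left ρ h, ← mul_assoc,
        quotLin_mul]
    have e' := congrArg (· * toConv (ρ.toLinearMap ∘ₗ antipode k)) e
    simp only [mul_assoc, (antipode_conv ρ).2, mul_one] at e'
    rw [L_mul, L_mul, e']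
  refine isGL_of ?_ ?_ comm
  · apply hl
    rw [ha, quotLin, one_repr_conv]
    simp
  · intro g g'
    apply hl
    -- `S(g₂h₂) = S(h₂) S(g₂)` brings the comparison at `h` between the two factors at `g`
    have e1 : l (a (g * g')) = (toConv ρ'.toLinearMap * constConv k H (l (a g')) *
        toConv (ρ.toLinearMap ∘ₗ antipode k)) g := by
      rw [ha, quotLin, ((ℛ k g).mul (ℛ k g')).convMul_apply, (ℛ k g).convMul_apply]
      simp only [mul_constConv, ha g', quotLin, (ℛ k g').convMul_apply]
      simp [Finset.sum_product, antipode_mul_antidistrib, Finset.mul_sum, Finset.sum_mul,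
        mul_assoc]
    rw [e1, ← orb_left ρ' h', mul_assoc, ← quotLin, ← hL, ← L_mul, comm]
    rfl

/-- Two actions on a bimodule whose right linear endomorphisms are the left multiplications differ
by a twist. -/
theorem exists_twistAct_eq {E : Bimod k B A} (hE : E.IsLeftFull)
    {ρ ρ' : H →ₐ[k] Module.End k E.carrier} (hl : LeftCompat E.left ρ)
    (hl' : LeftCompat E.left ρ') (hr : RightCompat E.right ρ) (hr' : RightCompat E.right ρ') :
    ∃ a : GLH k H B, twistAct E.left ρ hl a.val a.isGL = ρ' := by
  choose a ha using fun g => hE.exists_left (quotLin ρ ρ' g) fun a x => quotLin_right hr hr' g a x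
  let α : WithConv (H →ₗ[k] B) := toConv
    { toFun := a
      map_add' := fun g g' => hE.injective (by simp [ha])
      map_smul' := fun c g => hE.injective (by simp [ha]) }
  have hα : IsGL α := isGL_of_quotLin hE.injective hl hl' ha
  refine ⟨⟨α, hα⟩, ?_⟩
  ext1 g
  have e : toConv (E.left.toLinearMap ∘ₗ α.ofConv) = quotLin ρ ρ' := by
    ext g : 2
    exact ha g
  change (toConv (E.left.toLinearMap ∘ₗ α.ofConv) * toConv ρ.toLinearMap) g = _
  rw [e, quotLin_mul]
  rfl

end Comparison

/-! ### Isomorphisms of twisted bimodules -/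

/-- A bimodule automorphism of `E` is the multiplication by a central unit. -/
theorem Bimod.IsLeftFull.exists_center {k : Type w} {B A : Type u} [CommRing k] [Ring B]
    [Algebra k B] [Ring A] [Algebra k A] {E : Bimod k B A} (hE : E.IsLeftFull)
    {φ : E.carrier ≃ₗ[k] E.carrier} (hφ : IsBimodIso E E φ) :
    ∃ c : (Subring.center B)ˣ, ∀ x, φ x = E.left (c : B) x := by
  obtain ⟨c, hc⟩ := hE.exists_left φ.toLinearMap hφ.map_right
  obtain ⟨d, hd⟩ := hE.exists_left φ.symm.toLinearMap hφ.symm.map_right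
  have central {c : B} {φ : E.carrier ≃ₗ[k] E.carrier} (hφ : IsBimodIso E E φ)
      (hc : E.left c = φ.toLinearMap) : c ∈ Subring.center B := by
    refine Subring.mem_center_iff.mpr fun b => hE.injective ?_
    ext x
    rw [map_mul, map_mul, hc]
    exact (hφ.map_left b x).symm
  have hcd : c * d = 1 := hE.injective (by ext x; simp [hc, hd])
  have hdc : d * c = 1 := hE.injective (by ext x; simp [hc, hd])
  exact ⟨⟨⟨c, central hφ hc⟩, ⟨d, central hφ.symm hd⟩, Subtype.ext hcd, Subtype.ext hdc⟩,
    fun x => (congrArg (fun f => f x) hc).symm⟩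

theorem Bimod.isBimodIso_left {k : Type w} {B A : Type u} [CommRing k] [Ring B]
    [Algebra k B] [Ring A] [Algebra k A] (E : Bimod k B A) (c : (Subring.center B)ˣ) :
    ∃ φ : E.carrier ≃ₗ[k] E.carrier, IsBimodIso E E φ ∧ ∀ x, φ x = E.left (c : B) x := by
  have h1 : (c : B) * ((c⁻¹ : (Subring.center B)ˣ) : B) = 1 := congrArg Subtype.val c.mul_inv
  have h2 : ((c⁻¹ : (Subring.center B)ˣ) : B) * (c : B) = 1 := congrArg Subtype.val c.inv_mul
  refine ⟨LinearEquiv.ofLinearMap (E.left (c : B)) (E.left ((c⁻¹ : (Subring.center B)ˣ) : B))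
    ?_ ?_, ⟨fun b x => ?_, fun a x => E.left_right _ x a⟩, fun _ => rfl⟩
  · rw [← Module.End.mul_eq_comp, ← map_mul, h1, map_one]
    rfl
  · rw [← Module.End.mul_eq_comp, ← map_mul, h2, map_one]
    rfl
  · change (E.left (c : B) * E.left b) x = (E.left b * E.left (c : B)) x
    rw [← map_mul, ← map_mul, Subring.mem_center_iff.mp (c : Subring.center B).2 b]

/-- Transporting an action of `H` along a linear bijection. -/
noncomputable def transportAct {k : Type w} {H : Type v} [CommRing k] [Ring H] [HopfAlgebra k H]
    {M N : Type*} [AddCommGroup M] [Module k M] [AddCommGroup N] [Module k N] (e : M ≃ₗ[k] N)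
    (ρ : H →ₐ[k] Module.End k N) : H →ₐ[k] Module.End k M :=
  (e.symm.conjAlgEquiv k).toAlgHom.comp ρ

namespace HBimod

variable {k : Type w} {H : Type v} {B A : Type u} [CommRing k] [Ring H] [HopfAlgebra k H]
  [Ring B] [Algebra k B] [HopfAction k H B] [Ring A] [Algebra k A] [HopfAction k H A]

theorem map_twistAct {E F : HBimod k H B A} {e : E.carrier ≃ₗ[k] F.carrier}
    (h : IsHBimodIso E F e) (a : GLH k H B) (g : H) (x : E.carrier) :
    e (twistAct E.left E.act E.act_left a.val a.isGL g x) =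
      twistAct F.left F.act F.act_left a.val a.isGL g (e x) := by
  rw [twistAct_apply _ _ (ℛ k g), twistAct_apply _ _ (ℛ k g), map_sum]
  simp only [h.map_left, h.map_act]

theorem IsHBimodIso.twist {E F : HBimod k H B A} {e : E.carrier ≃ₗ[k] F.carrier}
    (h : IsHBimodIso E F e) (a : GLH k H B) :
    IsHBimodIso (HBimod.twist a E) (HBimod.twist a F) e :=
  ⟨h.toIsBimodIso, map_twistAct h a⟩

/-- An isomorphism from the twist of `E` by `a` to `E` is the multiplication by a central unit
`c`, and `a` belongs to `c⁻¹`. -/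
theorem exists_center_of_twist_iso {E : HBimod k H B A} (hE : E.IsLeftFull) {a : GLH k H B}
    {φ : E.carrier ≃ₗ[k] E.carrier} (hφ : IsHBimodIso (twist a E) E φ) :
    ∃ c : (Subring.center B)ˣ, hatHom k H B c⁻¹ = a ∧ ∀ x, φ x = E.left (c : B) x := by
  obtain ⟨c, hc⟩ := hE.exists_center hφ.toIsBimodIso
  refine ⟨c, hatHom_inv_eq a c (constConv_mul_eq_orb hE.injective E.act_left a c fun g x => ?_), hc⟩
  rw [← hc, ← hc]
  exact hφ.map_act g x

/-- The twist of `E` by the element belonging to `c` is isomorphic to `E` by `x ↦ c⁻¹ · x`. -/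
theorem isHBimodIso_twist_hat (E : HBimod k H B A) (c : (Subring.center B)ˣ) :
    ∃ φ : E.carrier ≃ₗ[k] E.carrier, IsHBimodIso (twist (hatHom k H B c) E) E φ ∧
      ∀ x, φ x = E.left ((c⁻¹ : (Subring.center B)ˣ) : B) x := by
  obtain ⟨φ, h, hφ⟩ := E.isBimodIso_left c⁻¹
  have h2 : ((c⁻¹ : (Subring.center B)ˣ) : B) * (c : B) = 1 := congrArg Subtype.val c.inv_mul
  have key (g : H) (x : E.carrier) :
      φ (twistAct E.left E.act E.act_left (hatHom k H B c).val (hatHom k H B c).isGL g x) =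
        E.act g (φ x) := by
    rw [twistAct_hat, hφ, hφ, ← Module.End.mul_apply, ← map_mul, h2, map_one]
    rfl
  exact ⟨φ, ⟨h, key⟩, hφ⟩

theorem mem_range_hatHom {E : HBimod k H B A} (hE : E.IsLeftFull) {a : GLH k H B}
    (h : ∃ e, IsHBimodIso (twist a E) E e) : a ∈ (hatHom k H B).range := by
  obtain ⟨e, he⟩ := h
  obtain ⟨c, hc, -⟩ := exists_center_of_twist_iso hE (a := a) (φ := e) he
  exact ⟨c⁻¹, hc⟩

theorem transport_left {E : Bimod k B A} {F : HBimod k H B A} {e : E.carrier ≃ₗ[k] F.carrier}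
    (h : Bimod.IsBimodIso E F.toBimod e) : LeftCompat E.left (transportAct e F.act) := by
  intro g ι r b x
  change e.symm (F.act g (e (E.left b x))) =
    ∑ i ∈ r.index, E.left (hact k (r.left i) b) (e.symm (F.act (r.right i) (e x)))
  simp only [h.map_left, ← h.symm.map_left, F.act_left g r, map_sum]

theorem transport_right {E : Bimod k B A} {F : HBimod k H B A} {e : E.carrier ≃ₗ[k] F.carrier}
    (h : Bimod.IsBimodIso E F.toBimod e) : RightCompat E.right (transportAct e F.act) := by
  intro g ι r x a
  change e.symm (F.act g (e (E.right (op a) x))) =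
    ∑ i ∈ r.index, E.right (op (hact k (r.right i) a)) (e.symm (F.act (r.left i) (e x)))
  simp only [h.map_right, ← h.symm.map_right, F.act_right g r, map_sum]

theorem exists_twistAct_eq_transportAct {E F : HBimod k H B A} (hE : E.IsLeftFull)
    {e : E.carrier ≃ₗ[k] F.carrier} (h : Bimod.IsBimodIso E.toBimod F.toBimod e) :
    ∃ a : GLH k H B, twistAct E.left E.act E.act_left a.val a.isGL = transportAct e F.act :=
  exists_twistAct_eq hE E.act_left (transport_left h) E.act_right (transport_right h)

theorem map_act_of_twistAct_eq {E F : HBimod k H B A} {e : E.carrier ≃ₗ[k] F.carrier}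
    {a : GLH k H B}
    (h : twistAct E.left E.act E.act_left a.val a.isGL = transportAct e F.act) (g : H)
    (x : E.carrier) : e (twistAct E.left E.act E.act_left a.val a.isGL g x) = F.act g (e x) := by
  rw [h]
  exact e.apply_symm_apply _

/-- Two actions on isomorphic bimodules differ by a twist. -/
theorem exists_twist_iso {E F : HBimod k H B A} (hE : E.IsLeftFull)
    (h : ∃ e, Bimod.IsBimodIso E.toBimod F.toBimod e) :
    ∃ a : GLH k H B, ∃ e, IsHBimodIso (twist a E) F e := by
  obtain ⟨e, he⟩ := h
  obtain ⟨a, ha⟩ := exists_twistAct_eq_transportAct hE he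
  exact ⟨a, e, he, map_act_of_twistAct_eq (E := E) (F := F) ha⟩

end HBimod

/-! ### Unitarity -/

namespace HInnerBimod

variable {k : Type w} {H : Type v} {B A : Type u} [CommRing k] [StarRing k] [Ring H]
  [HopfAlgebra k H] [StarRing H] [StarModule k H] [HopfStarAlgebra k H] [Ring B] [Algebra k B]
  [StarRing B] [StarModule k B] [HopfStarAction k H B] [Ring A] [Algebra k A] [StarRing A]
  [StarModule k A] [HopfStarAction k H A]

/-- If the action twisted by `a` is compatible with the inner product, then
`⟨S(g₁)^* ▷ x, a(S(g₂)^*)^* a(g₃) · (g₄ ▷ y)⟩ = g ▷ ⟨x, y⟩ = ⟨S(g₁)^* ▷ x, g₂ ▷ y⟩`, and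
cancellation shows that `a` is unitary. -/
theorem mem_UH_of_twist_inner (E : HInnerBimod k H B A) (hE : Function.Injective E.left)
    (a : GLH k H B)
    (h : ∀ (g : H) (x y : E.carrier), hact k g (E.inner x y) = ∑ i ∈ (ℛ k g).index,
      E.inner (twistAct E.left E.act E.act_left a.val a.isGL
          (star (antipode k ((ℛ k g).left i))) x)
        (twistAct E.left E.act E.act_left a.val a.isGL ((ℛ k g).right i) y)) :
    a ∈ UH k H B := by
  let γ : (E.carrier →ₗ[k] A) →ₗ[k] E.carrier →ₗ[k] A := LinearMap.id
  let κ : (E.carrier →ₗ[k] A) →ₗ[k] B →ₗ[k] (E.carrier →ₗ[k] A) :=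
    (LinearMap.llcomp k E.carrier E.carrier A).compl₂ E.left.toLinearMap
  let μ : B →ₗ[k] E.carrier →ₗ[k] E.carrier := E.left.toLinearMap
  let α : H →ₗ[k] B := a.val.ofConv
  let α' : H →ₗ[k] B := (dagger a.val).ofConv
  have e1 (x : E.carrier) (g : H) : sw κ (innerAct E x) α' g =
      E.inner (twistAct E.left E.act E.act_left a.val a.isGL (star (antipode k g)) x) := by
    ext z
    rw [sw_apply _ _ _ (ℛ k g), twistAct_apply _ _ (starAntipodeRepr (ℛ k g)), inner_sum_left,
      LinearMap.sum_apply]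
    refine Finset.sum_congr rfl fun i _ => ?_
    change E.inner _ (E.left (star _) z) = _
    rw [E.inner_left, star_star]
    rfl
  have e2 (x : E.carrier) (f : H →ₗ[k] E.carrier) :
      sw γ (innerAct E x) f = sw (innerAct E x) LinearMap.id f := by
    ext g
    rw [sw_apply _ _ _ (ℛ k g), sw_apply _ _ _ (ℛ k g)]
    rfl
  have e3 (y : E.carrier) : sw μ (dagger a.val * a.val).ofConv (E.act.toLinearMap.flip y) =
      E.act.toLinearMap.flip y := by
    refine E.inner_cancel fun x => ?_
    have e4 : sw μ (dagger a.val * a.val).ofConv (E.act.toLinearMap.flip y) =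
        sw μ α' (sw μ α (E.act.toLinearMap.flip y)) :=
      sw_assoc (LinearMap.mul k B) μ μ μ (fun b b' z => by simp [μ]) _ _ _
    rw [sw_innerAct, ← e2, e4, ← sw_assoc κ γ μ γ (fun p b z => rfl)]
    ext g
    rw [sw_apply _ _ _ (ℛ k g)]
    refine Eq.trans ?_ (h g x y).symm
    refine Finset.sum_congr rfl fun i _ => ?_
    rw [e1, ← flip_twistAct E.act_left a y]
    rfl
  have e5 : dagger a.val * a.val = 1 := by
    apply twistLin_injective (ρ := E.act) hE
    rw [twistLin_one]
    ext g y
    have e6 := congrArg (fun f => f g) (e3 y)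
    rw [sw_apply _ _ _ (ℛ k g)] at e6
    rw [twistLin_apply _ (ℛ k g), LinearMap.sum_apply]
    exact e6
  have e6 : a.val * (a⁻¹).val = 1 := congrArg GLH.val (mul_inv_cancel a)
  refine (isUnitaryH_iff a.val).mpr ?_
  rwa [← left_inv_eq_right_inv e5 e6] at e6

theorem isIsometricIso_left_iff {E : InnerBimod k B A} (hE : Function.Injective E.left)
    {φ : E.carrier ≃ₗ[k] E.carrier} (hφ : Bimod.IsBimodIso E.toBimod E.toBimod φ)
    {c : (Subring.center B)ˣ} (hc : ∀ x, φ x = E.left (c : B) x) :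
    InnerBimod.IsIsometricIso E E φ ↔ c ∈ UZ B := by
  have key (x y : E.carrier) : E.inner (φ x) (φ y) = E.inner x (E.left (star (c : B) * c) y) := by
    rw [hc, hc, map_mul, Module.End.mul_apply, E.inner_left _ (star _), star_star]
  constructor
  · intro h
    have e : star (c : B) * c = 1 := hE <| by
      ext y
      refine E.ext_inner fun x => ?_
      rw [← key, h.map_inner, map_one]
      rfl
    have e' : (c : B) * star (c : B) = 1 := by
      rw [← Subring.mem_center_iff.mp (c : Subring.center B).2, e]
    exact Unitary.mem_iff.mpr ⟨e, e'⟩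
  · intro h
    refine ⟨hφ, fun x y => ?_⟩
    rw [key, Unitary.star_mul_self_of_mem h, map_one]
    rfl

theorem IsHIsometricIso.toHBimod {E F : HInnerBimod k H B A} {e : E.carrier ≃ₗ[k] F.carrier}
    (h : IsHIsometricIso E F e) : HBimod.IsHBimodIso E.toHBimod F.toHBimod e :=
  ⟨h.toIsBimodIso, h.map_act⟩

theorem IsHIsometricIso.twist {E F : HInnerBimod k H B A} {e : E.carrier ≃ₗ[k] F.carrier}
    (h : IsHIsometricIso E F e) (a : UH k H B) :
    IsHIsometricIso (HInnerBimod.twist a E) (HInnerBimod.twist a F) e :=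
  ⟨h.toIsIsometricIso, (h.toHBimod.twist a.1).map_act⟩

theorem twist_one (E : HInnerBimod k H B A) :
    IsHIsometricIso (twist 1 E) E (LinearEquiv.refl k _) :=
  ⟨⟨.refl _, fun _ _ => rfl⟩,
    fun g x => congrArg (fun f => f g x) (twistAct_one E.act_left)⟩

theorem twist_mul (a b : UH k H B) (E : HInnerBimod k H B A) :
    IsHIsometricIso (twist (a * b) E) (twist a (twist b E)) (LinearEquiv.refl k _) :=
  ⟨⟨.refl _, fun _ _ => rfl⟩,
    fun g x => congrArg (fun f => f g x) (twistAct_mul E.act_left a.1 b.1)⟩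

theorem exists_isHIsometricIso_twist_hat {E : HInnerBimod k H B A} (hE : Function.Injective E.left)
    {n : UH k H B} (hn : n ∈ (hatU k H B).range) : ∃ e, IsHIsometricIso (twist n E) E e := by
  obtain ⟨c, rfl⟩ := hn
  obtain ⟨φ, h, hφ⟩ := E.toHBimod.isHBimodIso_twist_hat c.1
  exact ⟨φ, (isIsometricIso_left_iff hE h.toIsBimodIso hφ).mpr (c⁻¹).2, h.map_act⟩

theorem mem_range_hatU {E : HInnerBimod k H B A} (hE : E.IsLeftFull) {a : UH k H B}
    (h : ∃ e, IsHIsometricIso (twist a E) E e) : a ∈ (hatU k H B).range := by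
  obtain ⟨φ, h⟩ := h
  obtain ⟨c, hc, hφ⟩ := HBimod.exists_center_of_twist_iso (E := E.toHBimod) (a := a.1) hE
    (φ := φ) ⟨h.toIsBimodIso, h.map_act⟩
  have hu : c ∈ UZ B :=
    (isIsometricIso_left_iff hE.injective h.toIsBimodIso hφ).mp h.toIsIsometricIso
  exact ⟨⟨c, hu⟩⁻¹, Subtype.ext hc⟩

theorem exists_twist_iso {E F : HInnerBimod k H B A} (hE : E.IsLeftFull)
    (h : ∃ e, InnerBimod.IsIsometricIso E.toInnerBimod F.toInnerBimod e) :
    ∃ a : UH k H B, ∃ e, IsHIsometricIso (twist a E) F e := by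
  obtain ⟨e, he⟩ := h
  obtain ⟨a, ha⟩ := HBimod.exists_twistAct_eq_transportAct (E := E.toHBimod) (F := F.toHBimod) hE
    he.toIsBimodIso
  have map_act (g : H) (x : E.carrier) :
      e (twistAct E.left E.act E.act_left a.val a.isGL g x) = F.act g (e x) :=
    HBimod.map_act_of_twistAct_eq (E := E.toHBimod) (F := F.toHBimod) ha g x
  have hu : a ∈ UH k H B := by
    refine E.mem_UH_of_twist_inner hE.injective a fun g x y => ?_
    rw [← he.map_inner, F.act_inner g (ℛ k g)]
    simp only [← he.map_inner, map_act]
  exact ⟨⟨a, hu⟩, e, he, map_act⟩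

end HInnerBimod

end HopfMorita

theorem mainTheorem1
    {R : Type w} [CommRing R] [LinearOrder R] [IsStrictOrderedRing R]
    {H : Type v} [Ring H] [HopfAlgebra (Cx R) H] [StarRing H] [StarModule (Cx R) H]
    [HopfStarAlgebra (Cx R) H]
    {B : Type u} [Ring B] [Algebra (Cx R) B] [StarRing B] [StarModule (Cx R) B]
    [HopfStarAction (Cx R) H B]
    {A : Type u} [Ring A] [Algebra (Cx R) A] [StarRing A] [StarModule (Cx R) A]
    [HopfStarAction (Cx R) H A] :
    -- strong Picard groupoids
    (Nonempty (StrPic R B A) →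
      IsEmpty (StrPicH R H B A) ∨
      ∃ _ : MulAction (U₀ (Cx R) H B) (StrPicH R H B A),
        (∀ (a : UH (Cx R) H B) (E : StrEqHBimod R H B A),
          ∃ h : (HInnerBimod.twist a E.1).IsStrongEquivalence,
            (QuotientGroup.mk a : U₀ (Cx R) H B) • (Quotient.mk _ E : StrPicH R H B A) =
              Quotient.mk _ ⟨HInnerBimod.twist a E.1, h⟩) ∧
        IsPrincipalBundle (U₀ (Cx R) H B) (Set.rangeFactorization (forgetStrPic R H B A))) ∧
    -- `*`-Picard groupoids
    (Nonempty (StarPic (Cx R) B A) →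
      IsEmpty (StarPicH (Cx R) H B A) ∨
      ∃ _ : MulAction (U₀ (Cx R) H B) (StarPicH (Cx R) H B A),
        (∀ (a : UH (Cx R) H B) (E : StarEqHBimod (Cx R) H B A),
          ∃ h : (HInnerBimod.twist a E.1).IsStarEquivalence,
            (QuotientGroup.mk a : U₀ (Cx R) H B) • (Quotient.mk _ E : StarPicH (Cx R) H B A) =
              Quotient.mk _ ⟨HInnerBimod.twist a E.1, h⟩) ∧
        IsPrincipalBundle (U₀ (Cx R) H B) (Set.rangeFactorization (forgetStarPic (Cx R) H B A))) ∧
    -- the ring-theoretic setting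
    (∀ {k : Type w} [CommRing k] {H' : Type v} [Ring H'] [HopfAlgebra k H']
      {B' : Type u} [Ring B'] [Algebra k B'] [HopfAction k H' B']
      {A' : Type u} [Ring A'] [Algebra k A'] [HopfAction k H' A'],
      Nonempty (Pic k B' A') →
        IsEmpty (PicH k H' B' A') ∨
        ∃ _ : MulAction (GL₀ k H' B') (PicH k H' B' A'),
          (∀ (a : GLH k H' B') (E : EqHBimod k H' B' A'),
            ∃ h : (HBimod.twist a E.1).IsEquivalence,
              (QuotientGroup.mk a : GL₀ k H' B') • (Quotient.mk _ E : PicH k H' B' A') =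
                Quotient.mk _ ⟨HBimod.twist a E.1, h⟩) ∧
          IsPrincipalBundle (GL₀ k H' B') (Set.rangeFactorization (forgetPic k H' B' A'))) := by
  refine ⟨fun _ => Or.inr ?_, fun _ => Or.inr ?_, ?_⟩
  · have hfull (E : StrEqHBimod R H B A) : E.1.IsLeftFull := by
      obtain ⟨_, F, _, he, hf⟩ := E.2.toInnerBimod
      exact InnerBimod.IsStarEquivalence.toBimod ⟨F, he, hf⟩ |>.isLeftFull
    obtain ⟨act, h1, h2⟩ := exists_mulAction_isPrincipalBundle
      (s := (hinnerSetoid (Cx R) H B A).comap (Subtype.val : StrEqHBimod R H B A → _))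
      (hatU (Cx R) H B).range (fun a E => ⟨HInnerBimod.twist a E.1, E.2.twist a⟩)
      (forgetStrPic R H B A)
      (fun E => ⟨_, E.1.twist_one⟩) (fun a b E => ⟨_, E.1.twist_mul a b⟩)
      (fun a _ _ ⟨e, he⟩ => ⟨e, he.twist a⟩)
      (fun n hn E => HInnerBimod.exists_isHIsometricIso_twist_hat (hfull E).injective hn)
      (fun _ _ => rfl) (fun a E h => HInnerBimod.mem_range_hatU (hfull E) h)
      (fun E F h => HInnerBimod.exists_twist_iso (hfull E) (Quotient.exact h))
    exact ⟨act, fun a E => ⟨E.2.twist a, h1 a E⟩, h2⟩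
  · have hfull (E : StarEqHBimod (Cx R) H B A) : E.1.IsLeftFull :=
      E.2.toInnerBimod.toBimod.isLeftFull
    obtain ⟨act, h1, h2⟩ := exists_mulAction_isPrincipalBundle
      (s := (hinnerSetoid (Cx R) H B A).comap (Subtype.val : StarEqHBimod (Cx R) H B A → _))
      (hatU (Cx R) H B).range (fun a E => ⟨HInnerBimod.twist a E.1, E.2.twist a⟩)
      (forgetStarPic (Cx R) H B A)
      (fun E => ⟨_, E.1.twist_one⟩) (fun a b E => ⟨_, E.1.twist_mul a b⟩)
      (fun a _ _ ⟨e, he⟩ => ⟨e, he.twist a⟩)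
      (fun n hn E => HInnerBimod.exists_isHIsometricIso_twist_hat (hfull E).injective hn)
      (fun _ _ => rfl) (fun a E h => HInnerBimod.mem_range_hatU (hfull E) h)
      (fun E F h => HInnerBimod.exists_twist_iso (hfull E) (Quotient.exact h))
    exact ⟨act, fun a E => ⟨E.2.twist a, h1 a E⟩, h2⟩
  · intro k _ H' _ _ B' _ _ _ A' _ _ _ _
    refine Or.inr ?_
    have hfull (E : EqHBimod k H' B' A') : E.1.IsLeftFull := E.2.toBimod.isLeftFull
    obtain ⟨act, h1, h2⟩ := exists_mulAction_isPrincipalBundle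
      (s := (hbimodSetoid k H' B' A').comap (Subtype.val : EqHBimod k H' B' A' → _))
      (hatHom k H' B').range (fun a E => ⟨HBimod.twist a E.1, E.2.twist a⟩)
      (forgetPic k H' B' A')
      (fun E => ⟨LinearEquiv.refl k _, .refl _,
        fun g x => congrArg (fun f => f g x) (twistAct_one E.1.act_left)⟩)
      (fun a b E => ⟨LinearEquiv.refl k _, .refl _,
        fun g x => congrArg (fun f => f g x) (twistAct_mul E.1.act_left a b)⟩)
      (fun a _ _ ⟨e, he⟩ => ⟨e, he.twist a⟩)
      (by
        rintro _ ⟨c, rfl⟩ E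
        obtain ⟨φ, h, -⟩ := E.1.isHBimodIso_twist_hat c
        exact ⟨φ, h⟩)
      (fun _ _ => rfl)
      (fun a E h => HBimod.mem_range_hatHom (hfull E) h)
      (fun E F h => HBimod.exists_twist_iso (hfull E) (Quotient.exact h))
    exact ⟨act, fun a E => ⟨E.2.twist a, h1 a E⟩, h2⟩
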